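/- Let $m\in\mathbb N$ and let $W$ be the discrete Schrödinger operator with matrix-valued potential on $\ell^2(\mathbb Z,\mathbb C^m)$, $$(Wu)(n)=-u(n-1)-u(n+1)+B(n)u(n),\qquad n\in\mathbb Z,$$ where the matrices $B(n)\in\mathbb C^{m\times m}$ are Hermitian and $\sup_n\|B(n)\|<\infty$ (that is, $W$ is the Jacobi operator $(Wu)(n)=A(n-1)^*u(n-1)+A(n)u(n+1)+B(n)u(n)$ with $A(n)=-\mathbb I$ for all $n$). Let $\lambda_j$ be the distinct eigenvalues of $W$ outside $[-2,2]$ and $m_j$ their multiplicities. Then $m_j\le m$ for every $j$, and the following holds. (i) For $\gamma>\frac12$ and $x\ge 2$ put $G_\gamma(x)=\int_2^{x}(E^2-4)^{1/2}(x-E)^{\gamma-3/2}\,\mathrm dE$, and let $\mathrm B(a,b)=\Gamma(a)\Gamma(b)/\Gamma(a+b)$. If $\sum_{n\in\mathbb Z}\operatorname{tr}\big(|B(n)|^{\gamma+1/2}\big)<\infty$, then for every $\varepsilon>0$ only finitely many $\lambda_j$ satisfy $|\lambda_j|\ge2+\varepsilon$ (so that they can be enumerated with $|\lambda_1|\ge|\lambda_2|\ge\dots$),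 and $$\sum_j m_j\,G_\gamma(|\lambda_j|)\le \mathrm B\big(\gamma-\tfrac12,2\big)\sum_{n\in\mathbb Z}\operatorname{tr}\big(|B(n)|^{\gamma+1/2}\big),$$ where the sum on the left converges. (ii) For each $j$ there is a unique real $k_j$ with $|k_j|\ge1$ and $\lambda_j=-k_j-\frac1{k_j}$. For $\gamma=\frac32$ one has $G_{3/2}(|\lambda_j|)=\frac12\big(k_j^2-k_j^{-2}-\log|k_j|^4\big)$ and $\mathrm B(1,2)\operatorname{tr}(|B(n)|^2)=\frac12\operatorname{tr}(B(n)^2)$, so that the inequality in (i) reads $$\sum_j m_j\Big(k_j^2-\frac1{k_j^2}-\log|k_j|^4\Big)\le\sum_{n\in\mathbb Z}\operatorname{tr}\big(B(n)^2\big).$$ (iii) For $\gamma=\frac52$ and $\gamma=\frac72$, $G_\gamma(|\lambda_j|)$ equals the term in parentheses on the left below, and the inequality in (i) reads, respectively, $$\sum_{j}m_j \left(\frac32\Big(|k_j|-\frac{1}{|k_j|}\Big)+\frac16\Big(|k_j|^3-\frac{1}{|k_j|^3}\Big)-\log(|k_j|^2)\Big(|k_j|+\frac{1}{|k_j|}\Big)\right)\le\frac16\sum_{n\in\mathbb{Z}}\operatorname{tr}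 \big(|B(n)|^{3}\big),$$ $$\sum_{j}m_j \left(\frac{1}{12}\Big(k_j^4-\frac{1}{k_j^4}\Big)+\frac73\Big(k_j^2-\frac{1}{k_j^2}\Big)-\log(|k_j|^2)\Big(k_j^2+\frac{1}{k_j^2}\Big)-\log|k_j|^6\right)\le\frac{1}{12}\sum_{n\in\mathbb{Z}}\operatorname{tr} \big(|B(n)|^{4}\big).$$ In (ii) and (iii) each inequality is asserted whenever its right-hand side is finite, and the sum on its left then converges. -/

import Mathlib

open scoped Topology ENNReal Matrix

noncomputable section

/-- The Hilbert space `ℓ²(ℤ, ℂᵐ)`. -/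
abbrev EllTwo (m : ℕ) : Type :=
  lp (fun _ : ℤ => EuclideanSpace ℂ (Fin m)) 2

/-- The action of a complex `m × m` matrix on `ℂᵐ` with its Euclidean norm, as a bounded operator;
its norm is the operator norm of the matrix. -/
abbrev matAct {m : ℕ} (M : Matrix (Fin m) (Fin m) ℂ) :
    EuclideanSpace ℂ (Fin m) →L[ℂ] EuclideanSpace ℂ (Fin m) :=
  Matrix.toEuclideanCLM (n := Fin m) (𝕜 := ℂ) M

/-- Coefficients of a doubly infinite Jacobi operator with matrix entries: invertible off-diagonal
entries `A n → -I` as `|n| → ∞`, Hermitian potential `B n`, and both uniformly bounded. -/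
structure MatrixJacobi (m : ℕ) where
  A : ℤ → Matrix (Fin m) (Fin m) ℂ
  B : ℤ → Matrix (Fin m) (Fin m) ℂ
  isUnit_A : ∀ n, IsUnit (A n)
  tendsto_A : Filter.Tendsto A Filter.cofinite (𝓝 (-1))
  isHermitian_B : ∀ n, (B n).IsHermitian
  bounded_A : ∃ C : ℝ, ∀ n, ‖matAct (A n)‖ ≤ C
  bounded_B : ∃ C : ℝ, ∀ n, ‖matAct (B n)‖ ≤ C

/-- A uniformly bounded family of operators applied to an injective reindexing of a
square-summable sequence is square-summable. -/
theorem memlp_two_clm_comp {m : ℕ}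
    (T : ℤ → EuclideanSpace ℂ (Fin m) →L[ℂ] EuclideanSpace ℂ (Fin m))
    (hT : ∃ C : ℝ, ∀ n, ‖T n‖ ≤ C) (e : ℤ → ℤ) (he : Function.Injective e) (u : EllTwo m) :
    Memℓp (fun n => T n (u (e n))) 2 := by
  obtain ⟨C, hC⟩ := hT
  have h2 : (0 : ℝ) < (2 : ℝ≥0∞).toReal := by norm_num
  have hu : Summable fun n => ‖u n‖ ^ (2 : ℝ≥0∞).toReal := (lp.memℓp u).summable h2
  refine memℓp_gen (Summable.of_nonneg_of_le (fun n => by positivity) (fun n => ?_)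
    ((hu.comp_injective he).mul_left (C ^ (2 : ℝ≥0∞).toReal)))
  have hC0 : 0 ≤ C := (norm_nonneg _).trans (hC n)
  rw [Function.comp_apply, ← Real.mul_rpow hC0 (norm_nonneg _)]
  exact Real.rpow_le_rpow (norm_nonneg _)
    ((T n).le_of_opNorm_le (hC n) _) h2.le

namespace MatrixJacobi

variable {m : ℕ} (W : MatrixJacobi m)

theorem bounded_A_conjTranspose : ∃ C : ℝ, ∀ n, ‖matAct (W.A (n - 1))ᴴ‖ ≤ C := by
  obtain ⟨C, hC⟩ := W.bounded_A
  refine ⟨C, fun n => ?_⟩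
  have h : matAct (W.A (n - 1))ᴴ = star (matAct (W.A (n - 1))) :=
    map_star (Matrix.toEuclideanCLM (n := Fin m) (𝕜 := ℂ)) (W.A (n - 1))
  rw [h, ContinuousLinearMap.star_eq_adjoint, LinearIsometryEquiv.norm_map]
  exact hC _

/-- The Jacobi operator on `ℓ²(ℤ, ℂᵐ)`:
`(W u)(n) = A(n-1)* u(n-1) + A(n) u(n+1) + B(n) u(n)`. -/
def op : EllTwo m →ₗ[ℂ] EllTwo m where
  toFun u :=
    ⟨fun n => matAct (W.A (n - 1))ᴴ (u (n - 1)) + matAct (W.A n) (u (n + 1))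
        + matAct (W.B n) (u n),
      ((memlp_two_clm_comp (fun n => matAct (W.A (n - 1))ᴴ) W.bounded_A_conjTranspose
            (fun n => n - 1) (sub_left_injective) u).add
          (memlp_two_clm_comp (fun n => matAct (W.A n)) W.bounded_A
            (fun n => n + 1) (add_left_injective 1) u)).add
        (memlp_two_clm_comp (fun n => matAct (W.B n)) W.bounded_B
          (fun n => n) Function.injective_id u)⟩
  map_add' u v := by
    ext1
    funext n
    simp only [lp.coeFn_add, Pi.add_apply, map_add]
    abel
  map_smul' c u := by
    ext1
    funext n
    simp only [lp.coeFn_smul, Pi.smul_apply, map_smul, RingHom.id_apply, smul_add]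

/-- `W` is a discrete Schrödinger operator if `A(n) = -I` for all `n`. -/
def IsDiscreteSchrodinger : Prop := ∀ n, W.A n = -1

/-- The set of distinct eigenvalues of `W` outside `[-2, 2]`. (`W` is self-adjoint, so every
eigenvalue is real.) -/
def outerEigenvalues : Set ℝ :=
  {x | x ∉ Set.Icc (-2 : ℝ) 2 ∧ Module.End.HasEigenvalue W.op (x : ℂ)}

/-- The multiplicity of `x` as an eigenvalue of `W`. -/
def multiplicity (x : ℝ) : ℕ :=
  Module.finrank ℂ (Module.End.eigenspace W.op (x : ℂ))

end MatrixJacobi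

/-- `tr (|M|^p)` of a Hermitian matrix `M`, where `|M|^p` is given by the functional calculus. -/
def trAbsPow {m : ℕ} (M : Matrix (Fin m) (Fin m) ℂ) (p : ℝ) : ℝ :=
  (cfc (fun x : ℝ => |x| ^ p) M).trace.re

/-- `G_γ(x) = ∫₂ˣ (E² - 4)^{1/2} (x - E)^{γ - 3/2} dE`. -/
def GFun (γ x : ℝ) : ℝ :=
  ∫ E in (2 : ℝ)..x, (E ^ 2 - 4) ^ (1 / 2 : ℝ) * (x - E) ^ (γ - 3 / 2)

end

noncomputable section

/-! ### Shifts, sign flips and the free resolvent on `ℓ²(ℤ, ℂᵐ)` -/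

section FreeOperator

variable {m : ℕ}

/-! Let `T` be translation by one site. Alternating signs turn `W` into `T + T⁻¹ + B`, while `-W = T
+ T⁻¹ - B`; so both ends of the spectrum reduce to eigenvalues `E > 2` of an operator `T + T⁻¹ + B`.

The core is the sharp bound `∑ √(E² - 4) ≤ ∑ tr B₊` when `B₊` has finite support. Write `E = a +
1/a` with `0 < a < 1`, so that `√(E² - 4) = 1/a - a` and `(E - T - T⁻¹)⁻¹` has kernel `a^|n-k| /
(1/a - a)`. With `C = √B₊`, the Birman–Schwinger principle (`localizedOp_bound`) bounds `1/a - a` by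
a Rayleigh quotient of `K_a = C a^|n-k| C`. Sums of `K_a` over orthonormal families can only be
increased by raising `a` (`kyFanLE_geometric`): lowering the weight of one link amounts to averaging
the form with a conjugate of it by signs. Hence the eigenvalues can be absorbed one at a time, from
the largest down (`exists_orthonormal_sum_le`), and all carried to `a = 1`, where `K_1` has trace `∑
tr B₊` (`sum_bsForm_one_le`).

General `γ` follows by the Aizenman–Lieb argument (`sum_GFun_le`): apply the core bound to `B - t`,
whose positive part has finite support for each `t > 0`, and integrate against `t^(γ - 3/2) dt`. The
left side becomes `G_γ`, the right side the Beta function times `tr B₊^(γ + 1/2)`. The bound on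
multiplicities is a Wronskian argument (`rank_eigenspace_le`). -/

theorem ellTwo_hasSum_norm_sq (u : EllTwo m) : HasSum (fun n => ‖u n‖ ^ 2) (‖u‖ ^ 2) := by
  have h := lp.hasSum_norm (p := 2) (by norm_num) u
  simpa using h

/-- Translation by `k`, an isometry of `ℓ²(ℤ, ℂᵐ)`. -/
def latticeShift (k : ℤ) : EllTwo m →ₗᵢ[ℂ] EllTwo m where
  toFun u := ⟨fun n => u (n + k),
    memlp_two_clm_comp (fun _ => ContinuousLinearMap.id ℂ _) ⟨‖ContinuousLinearMap.id ℂ _‖,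
      fun _ => le_rfl⟩ (fun n => n + k) (add_left_injective k) u⟩
  map_add' _ _ := rfl
  map_smul' _ _ := rfl
  norm_map' u := by
    have h1 := ellTwo_hasSum_norm_sq u
    have h2 := (Equiv.addRight k).hasSum_iff.mpr h1
    have h3 := ellTwo_hasSum_norm_sq (m := m) (⟨fun n => u (n + k),
      memlp_two_clm_comp (fun _ => ContinuousLinearMap.id ℂ _) ⟨‖ContinuousLinearMap.id ℂ _‖,
      fun _ => le_rfl⟩ (fun n => n + k) (add_left_injective k) u⟩ : EllTwo m)
    have h4 := h3.unique h2
    exact (sq_eq_sq₀ (norm_nonneg _) (norm_nonneg _)).mp h4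

@[simp] theorem latticeShift_apply (k : ℤ) (u : EllTwo m) (n : ℤ) :
    latticeShift k u n = u (n + k) := rfl

/-- Multiplication by a sequence of signs, an isometry of `ℓ²(ℤ, ℂᵐ)`. -/
def signFlip (ε : ℤ → ℤˣ) : EllTwo m →ₗᵢ[ℂ] EllTwo m where
  toFun u := ⟨fun n => ((ε n : ℤ) : ℂ) • u n, by
    refine (lp.memℓp u).mono' ?_
    intro n
    rcases Int.units_eq_one_or (ε n) with h | h <;> simp [h]⟩
  map_add' u v := by
    ext1; funext n
    exact smul_add _ _ _
  map_smul' c u := by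
    ext1; funext n
    simp [smul_comm c]
  norm_map' u := by
    have h1 := ellTwo_hasSum_norm_sq u
    refine (sq_eq_sq₀ (norm_nonneg _) (norm_nonneg _)).mp ((ellTwo_hasSum_norm_sq _).unique ?_)
    convert h1 using 3 with n
    rcases Int.units_eq_one_or (ε n) with h | h <;> simp [h]

@[simp] theorem signFlip_apply (ε : ℤ → ℤˣ) (u : EllTwo m) (n : ℤ) :
    signFlip ε u n = ((ε n : ℤ) : ℂ) • u n := rfl

/-- The operator `E - T - T⁻¹`, where `T` is the translation by `1`. -/
def freeOp (m : ℕ) (E : ℝ) : EllTwo m →ₗ[ℂ] EllTwo m :=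
  (E : ℂ) • LinearMap.id - (latticeShift 1).toLinearMap - (latticeShift (-1)).toLinearMap

theorem freeOp_apply (E : ℝ) (u : EllTwo m) :
    freeOp m E u = (E : ℂ) • u - latticeShift 1 u - latticeShift (-1) u := rfl

theorem inner_latticeShift_left (k : ℤ) (u v : EllTwo m) :
    inner ℂ (latticeShift k u) v = inner ℂ u (latticeShift (-k) v) := by
  have h : latticeShift k (latticeShift (-k) v) = v := by
    ext1; funext n; simp
  conv_lhs => rw [← h]
  exact (latticeShift k).inner_map_map _ _

theorem freeOp_isSymmetric (E : ℝ) : (freeOp m E).IsSymmetric := by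
  intro u v
  simp only [freeOp_apply, inner_sub_left, inner_sub_right, inner_smul_left, inner_smul_right,
    inner_latticeShift_left, Complex.conj_ofReal, neg_neg]
  ring

theorem re_inner_freeOp_ge (E : ℝ) (u : EllTwo m) :
    (E - 2) * ‖u‖ ^ 2 ≤ (inner ℂ u (freeOp m E u)).re := by
  have h (k : ℤ) : (inner ℂ u (latticeShift k u)).re ≤ ‖u‖ ^ 2 := by
    have := re_inner_le_norm (𝕜 := ℂ) u (latticeShift k u)
    rw [LinearIsometry.norm_map, ← sq] at this
    exact this
  have h1 := h 1
  have h2 := h (-1)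
  have h3 : (inner ℂ u u) = ((‖u‖ ^ 2 : ℝ) : ℂ) := by
    rw [inner_self_eq_norm_sq_to_K]; push_cast; rfl
  rw [freeOp_apply, inner_sub_right, inner_sub_right, inner_smul_right, h3, ← Complex.ofReal_mul]
  simp only [Complex.sub_re, Complex.ofReal_re]
  linarith

theorem memlp_geometric {a : ℝ} (ha0 : 0 < a) (ha1 : a < 1) (k : ℤ)
    (v : EuclideanSpace ℂ (Fin m)) :
    Memℓp (fun n : ℤ => ((a : ℂ) ^ (n - k).natAbs) • v) 2 := by
  refine memℓp_gen ?_
  have h1 : Summable fun n : ℤ => (a ^ 2) ^ n.natAbs := by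
    have hs : Summable fun n : ℕ => (a ^ 2) ^ n :=
      summable_geometric_of_lt_one (by positivity) (by nlinarith)
    refine Summable.of_nat_of_neg ?_ ?_ <;> simpa using hs
  have h2 := ((h1.comp_injective (sub_left_injective (b := k))).mul_right (‖v‖ ^ 2))
  refine h2.congr fun n => ?_
  simp only [Function.comp_apply, ENNReal.toReal_ofNat, Real.rpow_ofNat, norm_smul, norm_pow,
    Complex.norm_real, Real.norm_eq_abs, abs_of_pos ha0]
  rw [mul_pow, ← pow_mul, ← pow_mul, mul_comm 2]

/-- `a` and `a⁻¹` are the roots of the characteristic equation, so `a ^ |j|` solves the recurrence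
on each side of `0`; the kink at `0` produces a point mass. This identifies the Green kernel of `E -
T - T⁻¹`. -/
theorem greenKernel_recurrence {a : ℝ} (ha0 : a ≠ 0) (j : ℤ) :
    (a + a⁻¹) * a ^ j.natAbs - a ^ (j + 1).natAbs - a ^ (j + -1).natAbs
      = if j = 0 then a⁻¹ - a else 0 := by
  rcases lt_trichotomy j 0 with h | h | h
  · obtain ⟨l, hl⟩ : ∃ l : ℕ, j = -(l : ℤ) - 1 := ⟨(-j - 1).toNat, by omega⟩
    have e1 : j.natAbs = l + 1 := by omega
    have e2 : (j + 1).natAbs = l := by omega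
    have e3 : (j + -1).natAbs = l + 2 := by omega
    rw [e1, e2, e3, if_neg (by omega)]
    field_simp
    ring
  · subst h
    simp
  · obtain ⟨l, hl⟩ : ∃ l : ℕ, j = (l : ℤ) + 1 := ⟨(j - 1).toNat, by omega⟩
    have e1 : j.natAbs = l + 1 := by omega
    have e2 : (j + 1).natAbs = l + 2 := by omega
    have e3 : (j + -1).natAbs = l := by omega
    rw [e1, e2, e3, if_neg (by omega)]
    field_simp
    ring

theorem exists_freeOp_eq_sum_single {a : ℝ} (ha0 : 0 < a) (ha1 : a < 1) (S : Finset ℤ)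
    (w : ℤ → EuclideanSpace ℂ (Fin m)) :
    ∃ z : EllTwo m, (∀ n, z n = ∑ k ∈ S, ((a : ℂ) ^ (n - k).natAbs) • w k) ∧
      freeOp m (a + a⁻¹) z = ((a⁻¹ - a : ℝ) : ℂ) • ∑ k ∈ S, lp.single 2 k (w k) := by
  let y (k : ℤ) : EllTwo m := ⟨_, memlp_geometric ha0 ha1 k (w k)⟩
  have hy (k n : ℤ) : y k n = ((a : ℂ) ^ (n - k).natAbs) • w k := rfl
  refine ⟨∑ k ∈ S, y k, fun n => ?_, ?_⟩
  · rw [lp.coeFn_sum, Finset.sum_apply]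
  · rw [map_sum, Finset.smul_sum]
    refine Finset.sum_congr rfl fun k _ => ?_
    ext1; funext n
    simp only [freeOp_apply, lp.coeFn_sub, lp.coeFn_smul, Pi.sub_apply, Pi.smul_apply,
      latticeShift_apply, hy, lp.coeFn_single]
    have h := greenKernel_recurrence ha0.ne' (n - k)
    rw [show n - k + 1 = n + 1 - k by ring, show n - k + -1 = n + -1 - k by ring] at h
    have h' := congrArg Complex.ofReal h
    rw [smul_smul, ← sub_smul, ← sub_smul]
    by_cases hnk : n = k
    · subst hnk
      rw [Pi.single_eq_same, if_pos (by ring)] at *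
      rw [← h']; push_cast; rfl
    · rw [Pi.single_eq_of_ne hnk, smul_zero]
      rw [if_neg (by omega)] at h'
      push_cast at h'
      push_cast
      rw [h', zero_smul]

/-- If `⟨u, (E - T - T⁻¹) u⟩ ≤ ⟨u, w⟩` with `w` supported on `S` and `E = a + 1/a`, then
`⟨u, w⟩ ≤ ⟨w, (E - T - T⁻¹)⁻¹ w⟩`. -/
theorem birmanSchwinger_ineq {a : ℝ} (ha0 : 0 < a) (ha1 : a < 1) (S : Finset ℤ)
    (w : ℤ → EuclideanSpace ℂ (Fin m)) (u : EllTwo m)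
    (h : (inner ℂ u (freeOp m (a + a⁻¹) u)).re ≤ ∑ n ∈ S, (inner ℂ (u n) (w n)).re) :
    (a⁻¹ - a) * ∑ n ∈ S, (inner ℂ (u n) (w n)).re ≤
      ∑ n ∈ S, ∑ k ∈ S, a ^ (n - k).natAbs * (inner ℂ (w k) (w n)).re := by
  obtain ⟨z, hz, hQz⟩ := exists_freeOp_eq_sum_single ha0 ha1 S w
  have hinv : 1 < a⁻¹ := (one_lt_inv₀ ha0).mpr ha1
  have hd : 0 < a⁻¹ - a := by linarith
  set d := a⁻¹ - a with hd_def
  have hE : 0 ≤ a + a⁻¹ - 2 := by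
    have h0 : a * a⁻¹ = 1 := mul_inv_cancel₀ ha0.ne'
    nlinarith [sq_nonneg (a - 1), sq_nonneg (a⁻¹ - 1)]
  have hs (x : EllTwo m) : (inner ℂ x (∑ k ∈ S, lp.single 2 k (w k))) =
      ∑ n ∈ S, inner ℂ (x n) (w n) := by
    rw [inner_sum]
    exact Finset.sum_congr rfl fun n _ => lp.inner_single_right n (w n) x
  -- Here `Q = E - T - T⁻¹` is nonnegative and `z = d Q⁻¹ w`. Expanding the form at `d u - z` and
  -- using `⟨u, Q u⟩ ≤ ⟨u, w⟩` to absorb the quadratic term in `u` leaves the claim.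
  have hpos : 0 ≤ (inner ℂ ((d : ℂ) • u - z) (freeOp m (a + a⁻¹) ((d : ℂ) • u - z))).re :=
    le_trans (by positivity) (re_inner_freeOp_ge _ _)
  have hzz : (inner ℂ z (freeOp m (a + a⁻¹) z)).re =
      d * ∑ n ∈ S, ∑ k ∈ S, a ^ (n - k).natAbs * (inner ℂ (w k) (w n)).re := by
    rw [hQz, inner_smul_right, hs, Complex.re_ofReal_mul, Complex.re_sum]
    congr 1
    refine Finset.sum_congr rfl fun n _ => ?_
    rw [hz, sum_inner, Complex.re_sum]
    refine Finset.sum_congr rfl fun k _ => ?_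
    rw [inner_smul_left, ← Complex.ofReal_pow, Complex.conj_ofReal, Complex.re_ofReal_mul]
  have huz : (inner ℂ u (freeOp m (a + a⁻¹) z)).re = d * ∑ n ∈ S, (inner ℂ (u n) (w n)).re := by
    rw [hQz, inner_smul_right, hs, Complex.re_ofReal_mul, Complex.re_sum]
  have hzu : (inner ℂ z (freeOp m (a + a⁻¹) u)).re =
      (inner ℂ u (freeOp m (a + a⁻¹) z)).re := by
    rw [← freeOp_isSymmetric, ← inner_conj_symm, Complex.conj_re]
  rw [map_sub, map_smul, inner_sub_left, inner_sub_right, inner_sub_right, inner_smul_left,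
    inner_smul_right, inner_smul_left, inner_smul_right, Complex.conj_ofReal] at hpos
  simp only [Complex.sub_re, Complex.re_ofReal_mul] at hpos
  rw [hzz, hzu, huz] at hpos
  have h5 : 0 ≤ d * (∑ n ∈ S, ∑ k ∈ S, a ^ (n - k).natAbs * (inner ℂ (w k) (w n)).re
      - d * ∑ n ∈ S, (inner ℂ (u n) (w n)).re) := by
    nlinarith [mul_le_mul_of_nonneg_left h (mul_nonneg hd.le hd.le)]
  have := nonneg_of_mul_nonneg_right h5 hd
  linarith

end FreeOperator

end

noncomputable section

/-! ### Birman–Schwinger forms and their monotonicity in the hopping parameter -/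

section BirmanSchwingerForm

variable {m : ℕ}

/-- The quadratic form `∑_{n,k ∈ S} K(n,k) ⟨C(k) f(k), C(n) f(n)⟩`. -/
def bsForm (S : Finset ℤ) (C : ℤ → EuclideanSpace ℂ (Fin m) →ₗ[ℂ] EuclideanSpace ℂ (Fin m))
    (K : ℤ → ℤ → ℝ) (f : EllTwo m) : ℝ :=
  ∑ n ∈ S, ∑ k ∈ S, K n k * (inner ℂ (C k (f k)) (C n (f n))).re

/-- Every sum of the form with kernel `K` over an orthonormal family is dominated by a sum of the
form with kernel `K'` over an orthonormal family of the same size. -/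
def KyFanLE (S : Finset ℤ) (C : ℤ → EuclideanSpace ℂ (Fin m) →ₗ[ℂ] EuclideanSpace ℂ (Fin m))
    (K K' : ℤ → ℤ → ℝ) : Prop :=
  ∀ (N : ℕ) (g : Fin N → EllTwo m), Orthonormal ℂ g →
    ∃ g' : Fin N → EllTwo m, Orthonormal ℂ g' ∧
      ∑ i, bsForm S C K (g i) ≤ ∑ i, bsForm S C K' (g' i)

variable {S : Finset ℤ} {C : ℤ → EuclideanSpace ℂ (Fin m) →ₗ[ℂ] EuclideanSpace ℂ (Fin m)}

theorem KyFanLE.refl (K : ℤ → ℤ → ℝ) : KyFanLE S C K K := fun _ g hg => ⟨g, hg, le_rfl⟩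

theorem KyFanLE.trans {K K' K'' : ℤ → ℤ → ℝ} (h : KyFanLE S C K K') (h' : KyFanLE S C K' K'') :
    KyFanLE S C K K'' := fun N g hg => by
  obtain ⟨g', hg', hle⟩ := h N g hg
  obtain ⟨g'', hg'', hle'⟩ := h' N g' hg'
  exact ⟨g'', hg'', hle.trans hle'⟩

theorem bsForm_congr {K K' : ℤ → ℤ → ℝ} (h : ∀ n ∈ S, ∀ k ∈ S, K n k = K' n k) (f : EllTwo m) :
    bsForm S C K f = bsForm S C K' f :=
  Finset.sum_congr rfl fun n hn => Finset.sum_congr rfl fun k hk => by rw [h n hn k hk]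

theorem bsForm_smul (K : ℤ → ℤ → ℝ) (c : ℂ) (f : EllTwo m) :
    bsForm S C K (c • f) = ‖c‖ ^ 2 * bsForm S C K f := by
  simp only [bsForm, Finset.mul_sum]
  refine Finset.sum_congr rfl fun n _ => Finset.sum_congr rfl fun k _ => ?_
  rw [lp.coeFn_smul, Pi.smul_apply, Pi.smul_apply, map_smul, map_smul, inner_smul_left,
    inner_smul_right, ← mul_assoc, Complex.conj_mul', ← Complex.ofReal_pow, Complex.re_ofReal_mul]
  ring

theorem bsForm_signFlip (K : ℤ → ℤ → ℝ) (ε : ℤ → ℤˣ) (f : EllTwo m) :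
    bsForm S C K (signFlip ε f) =
      bsForm S C (fun n k => ((ε n : ℤ) : ℝ) * ((ε k : ℤ) : ℝ) * K n k) f := by
  refine Finset.sum_congr rfl fun n _ => Finset.sum_congr rfl fun k _ => ?_
  rw [signFlip_apply, signFlip_apply, map_smul, map_smul]
  rcases Int.units_eq_one_or (ε n) with h | h <;> rcases Int.units_eq_one_or (ε k) with h' | h' <;>
    simp [h, h']

/-- If `K` is a convex combination of `K'` and its conjugate by signs, then `K` is dominated
by `K'`. -/
theorem kyFanLE_of_signFlip {K K' : ℤ → ℤ → ℝ} (ε : ℤ → ℤˣ) {p q : ℝ} (hp : 0 ≤ p) (hq : 0 ≤ q)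
    (hpq : p + q = 1)
    (h : ∀ n k, K n k = p * K' n k + q * (((ε n : ℤ) : ℝ) * ((ε k : ℤ) : ℝ) * K' n k)) :
    KyFanLE S C K K' := by
  intro N g hg
  have hsum : ∑ i, bsForm S C K (g i) = p * ∑ i, bsForm S C K' (g i) +
      q * ∑ i, bsForm S C K' (signFlip ε (g i)) := by
    simp only [bsForm_signFlip, Finset.mul_sum, ← Finset.sum_add_distrib]
    refine Finset.sum_congr rfl fun i _ => ?_
    simp only [bsForm, Finset.mul_sum, ← Finset.sum_add_distrib]
    refine Finset.sum_congr rfl fun n _ => Finset.sum_congr rfl fun k _ => ?_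
    rw [h]; ring
  obtain rfl : q = 1 - p := by linarith
  -- A convex combination is at most the larger of its two terms, and the flipped family is still
  -- orthonormal.
  rcases le_total (∑ i, bsForm S C K' (g i)) (∑ i, bsForm S C K' (signFlip ε (g i))) with hle | hle
  · refine ⟨fun i => signFlip ε (g i), hg.comp_linearIsometry _, ?_⟩
    rw [hsum]
    beta_reduce
    nlinarith [mul_le_mul_of_nonneg_left hle hp]
  · refine ⟨g, hg, ?_⟩
    rw [hsum]
    nlinarith [mul_le_mul_of_nonneg_left hle hq]

/-- The kernel `∏ w(l)` over the links `l → l + 1` between two lattice sites. -/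
def linkKernel (w : ℤ → ℝ) (n k : ℤ) : ℝ := ∏ l ∈ Finset.Ico (min n k) (max n k), w l

theorem linkKernel_const (a : ℝ) (n k : ℤ) :
    linkKernel (fun _ => a) n k = a ^ (n - k).natAbs := by
  rw [linkKernel, Finset.prod_const, Int.card_Ico]
  congr 1
  omega

/-- Flipping the signs of all sites to the right of `l` negates exactly the kernel entries whose
path crosses the link `l`. Weights `(1 ± ρ) / 2` therefore multiply those entries by `ρ` and leave
the others unchanged. -/
theorem kyFanLE_linkKernel_update (w : ℤ → ℝ) (l : ℤ) {ρ c : ℝ} (h0 : 0 ≤ ρ) (h1 : ρ ≤ 1) :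
    KyFanLE S C (linkKernel (Function.update w l (ρ * c))) (linkKernel (Function.update w l c)) := by
  refine kyFanLE_of_signFlip (fun n => if l < n then -1 else 1) (p := (1 + ρ) / 2)
    (q := (1 - ρ) / 2) (by linarith) (by linarith) (by ring) fun n k => ?_
  by_cases hl : l ∈ Finset.Ico (min n k) (max n k)
  · have e (x : ℝ) : linkKernel (Function.update w l x) n k =
        x * ∏ j ∈ (Finset.Ico (min n k) (max n k)) \ {l}, w j := by
      rw [linkKernel, Finset.prod_update_of_mem hl]
    rw [e, e]
    rw [Finset.mem_Ico] at hl
    rcases le_total n k with hnk | hnk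
    · rw [min_eq_left hnk, max_eq_right hnk] at hl
      rw [if_neg (by omega), if_pos (by omega)]
      push_cast
      ring
    · rw [min_eq_right hnk, max_eq_left hnk] at hl
      rw [if_pos (by omega), if_neg (by omega)]
      push_cast
      ring
  · have e (x : ℝ) : linkKernel (Function.update w l x) n k =
        ∏ j ∈ Finset.Ico (min n k) (max n k), w j := by
      rw [linkKernel, Finset.prod_update_of_notMem hl]
    rw [e, e]
    rw [Finset.mem_Ico] at hl
    by_cases hn : l < n
    · rw [if_pos hn, if_pos (by omega)]
      push_cast
      ring
    · rw [if_neg hn, if_neg (by omega)]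
      push_cast
      ring

theorem kyFanLE_linkKernel_piecewise {a a' : ℝ} (ha : 0 ≤ a) (haa' : a ≤ a') (ha' : 0 < a')
    (Λ : Finset ℤ) :
    KyFanLE S C (linkKernel fun _ => a) (linkKernel fun l => if l ∈ Λ then a' else a) := by
  induction Λ using Finset.induction_on with
  | empty => simpa using KyFanLE.refl (linkKernel fun _ => a)
  | insert l Λ hl ih =>
    refine ih.trans ?_
    have h := kyFanLE_linkKernel_update (S := S) (C := C) (fun l => if l ∈ Λ then a' else a) l
      (ρ := a / a') (c := a') (by positivity) ((div_le_one ha').mpr haa')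
    rw [div_mul_cancel₀ _ ha'.ne'] at h
    convert h using 2
    · funext j
      by_cases hj : j = l
      · subst hj; simp [hl]
      · simp [hj]
    · funext j
      by_cases hj : j = l
      · subst hj; simp
      · simp [hj]

/-- The links can be raised from `a` to `a'` one at a time; only finitely many lie between sites of
the finite set `S`, so a bounded box of links suffices. -/
theorem kyFanLE_geometric {a a' : ℝ} (ha : 0 ≤ a) (haa' : a ≤ a') (ha' : 0 < a') :
    KyFanLE S C (fun n k => a ^ (n - k).natAbs) (fun n k => a' ^ (n - k).natAbs) := by
  obtain ⟨M, hM⟩ : ∃ M : ℕ, ∀ n ∈ S, n.natAbs ≤ M := ⟨S.sup Int.natAbs, fun n hn =>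
    Finset.le_sup (f := Int.natAbs) hn⟩
  intro N g hg
  obtain ⟨g', hg', hle⟩ :=
    kyFanLE_linkKernel_piecewise (S := S) (C := C) ha haa' ha' (Finset.Icc (-(M : ℤ)) M) N g hg
  refine ⟨g', hg', ?_⟩
  convert hle using 2 with i _ i _
  · exact bsForm_congr (fun n _ k _ => (linkKernel_const a n k).symm) _
  · refine bsForm_congr (fun n hn k hk => ?_) _
    rw [← linkKernel_const, linkKernel, linkKernel]
    refine Finset.prod_congr rfl fun l hl => ?_
    have h1 := hM n hn
    have h2 := hM k hk
    rw [Finset.mem_Ico] at hl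
    rw [if_pos]
    rw [Finset.mem_Icc]
    omega

/-- The form with constant kernel `1` has trace `∑ ‖C(n)‖²` (Hilbert–Schmidt norms). -/
theorem sum_bsForm_one_le (hC : ∀ n, (C n).IsSymmetric)
    (e : OrthonormalBasis (Fin m) ℂ (EuclideanSpace ℂ (Fin m))) {N : ℕ} (g : Fin N → EllTwo m)
    (hg : Orthonormal ℂ g) :
    ∑ i, bsForm S C (fun _ _ => 1) (g i) ≤ ∑ n ∈ S, ∑ k, ‖C n (e k)‖ ^ 2 := by
  let y (k : Fin m) : EllTwo m := ∑ n ∈ S, lp.single 2 n (C n (e k))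
  have hy (k : Fin m) : ‖y k‖ ^ 2 = ∑ n ∈ S, ‖C n (e k)‖ ^ 2 := by
    have := lp.norm_sum_single (p := 2) (by norm_num) (fun n => C n (e k)) S
    simpa using this
  -- The constant kernel gives `‖∑ C(n) f(n)‖²`. Expanded in `e`, this is a form of rank at most `m`
  -- built from the vectors `y k`, so Bessel's inequality finishes.
  have hform (i : Fin N) : bsForm S C (fun _ _ => 1) (g i) = ∑ k, ‖inner ℂ (g i) (y k)‖ ^ 2 := by
    have h1 : bsForm S C (fun _ _ => 1) (g i) = ‖∑ n ∈ S, C n (g i n)‖ ^ 2 := by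
      rw [← inner_self_eq_norm_sq (𝕜 := ℂ), inner_sum]
      simp only [sum_inner, bsForm, one_mul, RCLike.re_to_complex, Complex.re_sum]
    rw [h1, ← e.sum_sq_norm_inner_right]
    refine Finset.sum_congr rfl fun k _ => ?_
    rw [← norm_inner_symm]
    congr 2
    rw [inner_sum, sum_inner]
    refine Finset.sum_congr rfl fun n _ => ?_
    rw [lp.inner_single_right, hC]
  calc ∑ i, bsForm S C (fun _ _ => 1) (g i) = ∑ k, ∑ i, ‖inner ℂ (g i) (y k)‖ ^ 2 := by
        rw [Finset.sum_comm]; exact Finset.sum_congr rfl fun i _ => hform i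
    _ ≤ ∑ k, ‖y k‖ ^ 2 := Finset.sum_le_sum fun k _ => hg.sum_inner_products_le (y k)
    _ = ∑ n ∈ S, ∑ k, ‖C n (e k)‖ ^ 2 := by
        rw [Finset.sum_comm]; exact Finset.sum_congr rfl fun k _ => hy k

end BirmanSchwingerForm

end

noncomputable section

/-! ### The trace bound for the eigenvalue sums of a finitely supported perturbation -/

section TraceBound

variable {m : ℕ}

/-- The Hilbert–Schmidt norm does not depend on the basis. This allows a different eigenbasis at
each site, whereas the trace at `a = 1` is computed in one common basis. -/
theorem sum_norm_sq_symmetric_eq {C : EuclideanSpace ℂ (Fin m) →ₗ[ℂ] EuclideanSpace ℂ (Fin m)}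
    (hC : C.IsSymmetric) (e e' : OrthonormalBasis (Fin m) ℂ (EuclideanSpace ℂ (Fin m))) :
    ∑ k, ‖C (e k)‖ ^ 2 = ∑ k, ‖C (e' k)‖ ^ 2 := by
  have h1 (k : Fin m) : ‖C (e k)‖ ^ 2 = ∑ j, ‖inner ℂ (e' j) (C (e k))‖ ^ 2 :=
    (e'.sum_sq_norm_inner_right _).symm
  have h2 (k : Fin m) : ‖C (e' k)‖ ^ 2 = ∑ j, ‖inner ℂ (C (e' k)) (e j)‖ ^ 2 :=
    (e.sum_sq_norm_inner_left _).symm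
  simp only [h1, h2, hC _ _]
  exact Finset.sum_comm

/-- The operator `u ↦ ∑_{n ∈ S} C(n) u(n)` localized to a finite set of sites. -/
def localizedOp (S : Finset ℤ) (C : ℤ → EuclideanSpace ℂ (Fin m) →ₗ[ℂ] EuclideanSpace ℂ (Fin m)) :
    EllTwo m →ₗ[ℂ] EllTwo m where
  toFun u := ∑ n ∈ S, lp.single 2 n (C n (u n))
  map_add' u v := by
    simp only [lp.coeFn_add, Pi.add_apply, map_add, lp.single_add, Finset.sum_add_distrib]
  map_smul' c u := by
    simp only [lp.coeFn_smul, Pi.smul_apply, map_smul, lp.single_smul, Finset.smul_sum,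
      RingHom.id_apply]

variable {S : Finset ℤ} {C : ℤ → EuclideanSpace ℂ (Fin m) →ₗ[ℂ] EuclideanSpace ℂ (Fin m)}

theorem localizedOp_apply_of_mem (u : EllTwo m) {n : ℤ} (hn : n ∈ S) :
    localizedOp S C u n = C n (u n) := by
  change (∑ n ∈ S, lp.single 2 n (C n (u n)) : EllTwo m) n = _
  rw [lp.coeFn_sum, Finset.sum_apply, Finset.sum_eq_single n]
  · exact lp.single_apply_self _ _ _
  · intro k _ hk
    exact lp.single_apply_ne _ _ _ hk.symm
  · exact fun h => absurd hn h

theorem norm_sq_localizedOp (u : EllTwo m) :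
    ‖localizedOp S C u‖ ^ 2 = ∑ n ∈ S, ‖C n (u n)‖ ^ 2 := by
  have := lp.norm_sum_single (p := 2) (by norm_num) (fun n => C n (u n)) S
  change ‖(∑ n ∈ S, lp.single 2 n (C n (u n)) : EllTwo m)‖ ^ 2 = _
  simpa using this

theorem two_lt_add_inv {a : ℝ} (ha0 : 0 < a) (ha1 : a < 1) : 2 < a + a⁻¹ := by
  have h0 : a * a⁻¹ = 1 := mul_inv_cancel₀ ha0.ne'
  have hinv : 1 < a⁻¹ := (one_lt_inv₀ ha0).mpr ha1
  nlinarith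

/-- This is the Birman–Schwinger inequality with `w = C² u`, for which `⟨u, w⟩ = ‖C u‖²` and the
right side is the form at `C u`. -/
theorem localizedOp_bound (hC : ∀ n, (C n).IsSymmetric) {a : ℝ} (ha0 : 0 < a) (ha1 : a < 1)
    (u : EllTwo m)
    (h : (inner ℂ u (freeOp m (a + a⁻¹) u)).re ≤ ∑ n ∈ S, ‖C n (u n)‖ ^ 2) :
    (a⁻¹ - a) * ‖localizedOp S C u‖ ^ 2 ≤
      bsForm S C (fun n k => a ^ (n - k).natAbs) (localizedOp S C u) := by
  have hw (n : ℤ) : (inner ℂ (u n) (C n (C n (u n)))).re = ‖C n (u n)‖ ^ 2 := by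
    rw [← hC, ← inner_self_eq_norm_sq (𝕜 := ℂ)]; rfl
  have h1 := birmanSchwinger_ineq ha0 ha1 S (fun n => C n (C n (u n))) u (by simpa only [hw] using h)
  simp only [hw] at h1
  rw [norm_sq_localizedOp]
  refine h1.trans_eq ?_
  refine Finset.sum_congr rfl fun n hn => Finset.sum_congr rfl fun k hk => ?_
  rw [localizedOp_apply_of_mem _ hn, localizedOp_apply_of_mem _ hk]

/-- Eigenvalues are absorbed in order of increasing `a`, that is, of decreasing `E`. The family
found so far is first carried to the parameter `a i` of the new eigenvalue and extended there by one
vector; monotonicity in `a` then moves the longer family on to `a'`, which is why `a'` is left free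
in the induction. The hypothesis `h` concerns whole spans because the new vector is a combination of
the eigenvectors seen so far. -/
theorem exists_orthonormal_sum_le {ι : Type*} [Fintype ι] [DecidableEq ι]
    (hC : ∀ n, (C n).IsSymmetric) {a : ι → ℝ} (ha0 : ∀ i, 0 < a i) (ha1 : ∀ i, a i < 1)
    {u : ι → EllTwo m} (hu : LinearIndependent ℂ u)
    (h : ∀ i, ∀ c : ι → ℂ, (∀ j, c j ≠ 0 → a j ≤ a i) →
      (inner ℂ (∑ j, c j • u j) (freeOp m (a i + (a i)⁻¹) (∑ j, c j • u j))).re ≤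
        ∑ n ∈ S, ‖C n ((∑ j, c j • u j : EllTwo m) n)‖ ^ 2) (s : Finset ι) :
    ∀ a', 0 < a' → (∀ i ∈ s, a i ≤ a') → ∃ N, N ≤ s.card ∧ ∃ g : Fin N → EllTwo m,
      Orthonormal ℂ g ∧
      ∑ i ∈ s, ((a i)⁻¹ - a i) ≤ ∑ i, bsForm S C (fun n k => a' ^ (n - k).natAbs) (g i) := by
  induction s using Finset.induction_on_max_value a with
  | empty => exact fun _ _ _ => ⟨0, le_rfl, ![], by simp [Orthonormal], by simp⟩
  | insert i s hi hmax ih =>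
    intro a' ha' hle
    obtain ⟨N, hN, g, hg, hsum⟩ := ih (a i) (ha0 i) hmax
    -- Orthogonality to `g` imposes `N ≤ s.card` linear conditions on `s.card + 1` coefficients, so
    -- a nonzero solution exists.
    obtain ⟨c, hc, hcs, hne⟩ : ∃ c : ι → ℂ,
        (∀ j : Fin N, inner ℂ (g j) (localizedOp S C (∑ k, c k • u k)) = 0) ∧
        (∀ j, c j ≠ 0 → j ∈ insert i s) ∧ c ≠ 0 := by
      have hdep : ¬ LinearIndepOn ℂ
          (fun k => fun j : Fin N => (inner ℂ (g j) (localizedOp S C (u k)) : ℂ))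
          (insert i s : Finset ι) := by
        intro hli
        have := LinearIndependent.fintype_card_le_finrank hli
        simp only [Finset.coe_sort_coe, Fintype.card_coe, Module.finrank_fintype_fun_eq_card,
          Fintype.card_fin] at this
        rw [Finset.card_insert_of_notMem hi] at this
        omega
      rw [not_linearIndepOn_finset_iff] at hdep
      obtain ⟨f, hf, k, hk, hfk⟩ := hdep
      refine ⟨fun k => if k ∈ insert i s then f k else 0, fun j => ?_, fun j hj => ?_, ?_⟩
      · have := congrFun hf j
        simp only [Finset.sum_apply, Pi.smul_apply, Pi.zero_apply, smul_eq_mul] at this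
        rw [map_sum, inner_sum]
        simp only [map_smul, inner_smul_right, ite_mul, zero_mul]
        rw [Finset.sum_ite_mem, Finset.univ_inter]
        exact this
      · by_contra hjs
        simp [hjs] at hj
      · intro h0
        have := congrFun h0 k
        simp only [hk, if_true, Pi.zero_apply] at this
        exact hfk this
    set x : EllTwo m := ∑ k, c k • u k with hx
    have hx0 : x ≠ 0 := by
      intro h0
      apply hne
      funext k
      exact Fintype.linearIndependent_iff.mp hu c h0 k
    have hform := h i c (fun j hj => by
      rcases Finset.mem_insert.mp (hcs j hj) with rfl | hj'
      · exact le_rfl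
      · exact hmax j hj')
    have hE := two_lt_add_inv (ha0 i) (ha1 i)
    set f := localizedOp S C x with hf
    -- The free form is strictly positive at `x ≠ 0` because `E > 2`, and `‖f‖²` dominates it.
    have hf0 : 0 < ‖f‖ := by
      have h1 := re_inner_freeOp_ge (a i + (a i)⁻¹) x
      have h2 : 0 < ‖x‖ ^ 2 := by positivity
      have h3 : 0 < ‖f‖ ^ 2 := by
        rw [hf, norm_sq_localizedOp]
        have : 0 < (a i + (a i)⁻¹ - 2) * ‖x‖ ^ 2 := mul_pos (by linarith) h2
        linarith
      exact lt_of_le_of_ne (norm_nonneg _) fun h0 => by simp [← h0] at h3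
    have hbound := localizedOp_bound hC (ha0 i) (ha1 i) x hform
    have hg1 : Orthonormal ℂ (Matrix.vecCons (((‖f‖⁻¹ : ℝ) : ℂ) • f) g) := by
      refine orthonormal_vecCons_iff.mpr ⟨?_, fun j => ?_, hg⟩
      · rw [norm_smul, Complex.norm_real, norm_inv, norm_norm, inv_mul_cancel₀ hf0.ne']
      · rw [inner_smul_left, ← inner_conj_symm, hc j, map_zero, mul_zero]
    obtain ⟨g', hg', hle'⟩ := kyFanLE_geometric (S := S) (C := C) (ha0 i).le
      (hle i (Finset.mem_insert_self _ _)) ha' _ _ hg1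
    refine ⟨N + 1, ?_, g', hg', le_trans ?_ hle'⟩
    · rw [Finset.card_insert_of_notMem hi]; omega
    · rw [Fin.sum_univ_succ, Finset.sum_insert hi]
      refine add_le_add ?_ (by simpa using hsum)
      rw [Matrix.cons_val_zero, bsForm_smul, Complex.norm_real, norm_inv, norm_norm]
      calc (a i)⁻¹ - a i = ‖f‖⁻¹ ^ 2 * (((a i)⁻¹ - a i) * ‖f‖ ^ 2) := by
            field_simp
        _ ≤ _ := by gcongr

theorem sum_inv_sub_le_trace {ι : Type*} [Fintype ι]
    (hC : ∀ n, (C n).IsSymmetric) {a : ι → ℝ} (ha0 : ∀ i, 0 < a i) (ha1 : ∀ i, a i < 1)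
    {u : ι → EllTwo m} (hu : LinearIndependent ℂ u)
    (h : ∀ i, ∀ c : ι → ℂ, (∀ j, c j ≠ 0 → a j ≤ a i) →
      (inner ℂ (∑ j, c j • u j) (freeOp m (a i + (a i)⁻¹) (∑ j, c j • u j))).re ≤
        ∑ n ∈ S, ‖C n ((∑ j, c j • u j : EllTwo m) n)‖ ^ 2)
    (e : ℤ → OrthonormalBasis (Fin m) ℂ (EuclideanSpace ℂ (Fin m))) :
    ∑ i, ((a i)⁻¹ - a i) ≤ ∑ n ∈ S, ∑ k, ‖C n (e n k)‖ ^ 2 := by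
  classical
  obtain ⟨N, -, g, hg, hle⟩ := exists_orthonormal_sum_le hC ha0 ha1 hu h Finset.univ 1 one_pos
    (fun i _ => (ha1 i).le)
  refine hle.trans ?_
  simp only [one_pow]
  refine (sum_bsForm_one_le hC (e 0) g hg).trans_eq ?_
  exact Finset.sum_congr rfl fun n _ => sum_norm_sq_symmetric_eq (hC n) _ _

end TraceBound

end

noncomputable section

/-! ### Eigenvalue sums of the truncated operator -/

section Truncation

variable {m : ℕ}

/-- The operator with eigenbasis `e` and eigenvalues `c`. -/
def specOp (e : OrthonormalBasis (Fin m) ℂ (EuclideanSpace ℂ (Fin m))) (c : Fin m → ℝ) :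
    EuclideanSpace ℂ (Fin m) →ₗ[ℂ] EuclideanSpace ℂ (Fin m) where
  toFun u := ∑ k, ((c k : ℂ) * inner ℂ (e k) u) • e k
  map_add' u v := by
    simp only [inner_add_right, mul_add, add_smul, Finset.sum_add_distrib]
  map_smul' z u := by
    simp only [inner_smul_right, Finset.smul_sum, smul_smul, RingHom.id_apply]
    exact Finset.sum_congr rfl fun k _ => by ring_nf

variable (e : OrthonormalBasis (Fin m) ℂ (EuclideanSpace ℂ (Fin m))) (c : Fin m → ℝ)

theorem specOp_apply (u : EuclideanSpace ℂ (Fin m)) :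
    specOp e c u = ∑ k, ((c k : ℂ) * inner ℂ (e k) u) • e k := rfl

theorem specOp_isSymmetric : (specOp e c).IsSymmetric := by
  intro u v
  simp only [specOp_apply, sum_inner, inner_sum, inner_smul_left, inner_smul_right, map_mul,
    Complex.conj_ofReal, inner_conj_symm]
  exact Finset.sum_congr rfl fun k _ => by ring

theorem specOp_basis (k : Fin m) : specOp e c (e k) = (c k : ℂ) • e k := by
  rw [specOp_apply, Finset.sum_eq_single k]
  · simp
  · intro j _ hj
    rw [e.orthonormal.2 hj, mul_zero, zero_smul]
  · simp

theorem re_inner_specOp (u : EuclideanSpace ℂ (Fin m)) :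
    (inner ℂ u (specOp e c u)).re = ∑ k, c k * ‖inner ℂ (e k) u‖ ^ 2 := by
  rw [specOp_apply, inner_sum, Complex.re_sum]
  refine Finset.sum_congr rfl fun k _ => ?_
  rw [inner_smul_right, mul_assoc, Complex.re_ofReal_mul, ← inner_conj_symm u, Complex.mul_conj',
    ← Complex.ofReal_pow, Complex.ofReal_re]

theorem norm_sq_specOp (u : EuclideanSpace ℂ (Fin m)) :
    ‖specOp e c u‖ ^ 2 = ∑ k, c k ^ 2 * ‖inner ℂ (e k) u‖ ^ 2 := by
  rw [← e.sum_sq_norm_inner_right]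
  refine Finset.sum_congr rfl fun k _ => ?_
  rw [← specOp_isSymmetric, specOp_basis, inner_smul_left, norm_mul, mul_pow]
  simp

theorem re_inner_specOp_le (t : ℝ) (u : EuclideanSpace ℂ (Fin m)) :
    (inner ℂ u (specOp e c u)).re ≤
      t * ‖u‖ ^ 2 + ‖specOp e (fun k => √(max (c k - t) 0)) u‖ ^ 2 := by
  rw [re_inner_specOp, norm_sq_specOp, ← e.sum_sq_norm_inner_right u, Finset.mul_sum,
    ← Finset.sum_add_distrib]
  refine Finset.sum_le_sum fun k _ => ?_
  rw [Real.sq_sqrt (le_max_right _ _), ← add_mul]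
  gcongr
  linarith [le_max_left (c k - t) 0]

theorem norm_sq_specOp_sqrt_basis (k : Fin m) (t : ℝ) :
    ‖specOp e (fun k => √(max (c k - t) 0)) (e k)‖ ^ 2 = max (c k - t) 0 := by
  rw [specOp_basis, norm_smul, mul_pow, Complex.norm_real, Real.norm_eq_abs, sq_abs,
    Real.sq_sqrt (le_max_right _ _)]
  simp

/-- The solution in `(0, 1)` of `a + 1/a = E`. -/
def joukowskyInv (E : ℝ) : ℝ := (E - √(E ^ 2 - 4)) / 2

theorem joukowskyInv_spec {E : ℝ} (hE : 2 < E) :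
    0 < joukowskyInv E ∧ joukowskyInv E < 1 ∧ joukowskyInv E + (joukowskyInv E)⁻¹ = E ∧
      (joukowskyInv E)⁻¹ - joukowskyInv E = √(E ^ 2 - 4) := by
  have h4 : 0 < E ^ 2 - 4 := by nlinarith
  have hs := Real.sq_sqrt h4.le
  have hs0 := Real.sqrt_pos.mpr h4
  have hlt : √(E ^ 2 - 4) < E := by nlinarith
  have hpos : 0 < joukowskyInv E := by unfold joukowskyInv; linarith
  have hinv : (joukowskyInv E)⁻¹ = (E + √(E ^ 2 - 4)) / 2 := by
    rw [inv_eq_iff_eq_inv, eq_comm, inv_eq_of_mul_eq_one_left]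
    unfold joukowskyInv; linarith
  refine ⟨hpos, ?_, ?_, ?_⟩
  · unfold joukowskyInv; nlinarith
  · rw [hinv]; unfold joukowskyInv; ring
  · rw [hinv]; unfold joukowskyInv; ring

theorem le_of_joukowskyInv_le {E E' : ℝ} (hE : 2 < E) (hE' : 2 < E')
    (h : joukowskyInv E ≤ joukowskyInv E') : E' ≤ E := by
  obtain ⟨h0, h1, h2, -⟩ := joukowskyInv_spec hE
  obtain ⟨h0', h1', h2', -⟩ := joukowskyInv_spec hE'
  set a := joukowskyInv E
  set a' := joukowskyInv E'
  rw [← h2, ← h2', ← sub_nonneg]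
  have : a + a⁻¹ - (a' + a'⁻¹) = (a' - a) * (1 - a * a') / (a * a') := by
    field_simp; ring
  rw [this]
  have : a * a' ≤ 1 := by nlinarith
  apply div_nonneg (mul_nonneg (by linarith) (by linarith)) (by positivity)

/-- On a combination `u` of eigenvectors with eigenvalues at least `x`, `⟨u, (T + T⁻¹ + B) u⟩ ≥ x
‖u‖²`. Hence `⟨u, (x - t - T - T⁻¹) u⟩ ≤ ⟨u, (B - t) u⟩ ≤ ⟨u, (B - t)₊ u⟩`, and the last form lives
on `S`. -/
theorem truncated_form_le {e : ℤ → OrthonormalBasis (Fin m) ℂ (EuclideanSpace ℂ (Fin m))}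
    {b : ℤ → Fin m → ℝ} {ι : Type*} [Fintype ι] {v : ι → EllTwo m} (hv : Orthonormal ℂ v)
    {lam : ι → ℝ}
    (heq : ∀ i n, v i (n - 1) + v i (n + 1) + specOp (e n) (b n) (v i n) = (lam i : ℂ) • v i n)
    {t : ℝ} {S : Finset ℤ} (hS : ∀ n ∉ S, ∀ k, b n k ≤ t) {x : ℝ} (c : ι → ℂ)
    (hc : ∀ j, c j ≠ 0 → x ≤ lam j) :
    (inner ℂ (∑ j, c j • v j) (freeOp m (x - t) (∑ j, c j • v j))).re ≤
      ∑ n ∈ S, ‖specOp (e n) (fun k => √(max (b n k - t) 0)) ((∑ j, c j • v j : EllTwo m) n)‖ ^ 2 := by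
  set u : EllTwo m := ∑ j, c j • v j with hu
  set y : EllTwo m := ∑ j, (c j * lam j) • v j with hy
  have hun (n : ℤ) : u n = ∑ j, c j • v j n := by
    rw [hu, lp.coeFn_sum, Finset.sum_apply]; rfl
  have hyn (n : ℤ) : y n = ∑ j, (c j * lam j) • v j n := by
    rw [hy, lp.coeFn_sum, Finset.sum_apply]; rfl
  -- `d` is `B u`, read off from the eigenvalue equation; it is thus in `ℓ²` without any bound on
  -- `b`.
  set d : EllTwo m := y - latticeShift 1 u - latticeShift (-1) u with hd
  have hdn (n : ℤ) : d n = specOp (e n) (b n) (u n) := by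
    rw [hd]
    simp only [lp.coeFn_sub, Pi.sub_apply, latticeShift_apply, hyn, hun, map_sum, map_smul,
      ← Finset.sum_sub_distrib]
    refine Finset.sum_congr rfl fun j _ => ?_
    rw [mul_smul, ← heq j n, ← sub_eq_add_neg]
    module
  have hQ : freeOp m (x - t) u = ((x - t : ℝ) : ℂ) • u - y + d := by
    rw [freeOp_apply, hd]; abel
  have huu : inner ℂ u u = ((‖u‖ ^ 2 : ℝ) : ℂ) := by
    rw [inner_self_eq_norm_sq_to_K]; push_cast; rfl
  have hnorm : ‖u‖ ^ 2 = ∑ j, ‖c j‖ ^ 2 := by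
    have : (((‖u‖ ^ 2 : ℝ) : ℂ)) = ((∑ j, ‖c j‖ ^ 2 : ℝ) : ℂ) := by
      rw [← huu, hu, hv.inner_sum]
      push_cast
      exact Finset.sum_congr rfl fun j _ => Complex.conj_mul' _
    exact_mod_cast this
  have huy : x * ‖u‖ ^ 2 ≤ (inner ℂ u y).re := by
    rw [hu, hy, hv.inner_sum, ← hu, hnorm, Finset.mul_sum, Complex.re_sum]
    refine Finset.sum_le_sum fun j _ => ?_
    rw [← mul_assoc, Complex.conj_mul', ← Complex.ofReal_pow, ← Complex.ofReal_mul,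
      Complex.ofReal_re]
    by_cases h0 : c j = 0
    · simp [h0]
    · rw [mul_comm]
      gcongr
      exact hc j h0
  have hud : (inner ℂ u d).re ≤ t * ‖u‖ ^ 2 +
      ∑ n ∈ S, ‖specOp (e n) (fun k => √(max (b n k - t) 0)) (u n)‖ ^ 2 := by
    have h1 : HasSum (fun n => (inner ℂ (u n) (d n)).re) (inner ℂ u d).re :=
      Complex.hasSum_re (lp.hasSum_inner u d)
    have h2 := (ellTwo_hasSum_norm_sq u).mul_left t
    have h3 : HasSum (fun n => ‖specOp (e n) (fun k => √(max (b n k - t) 0)) (u n)‖ ^ 2)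
        (∑ n ∈ S, ‖specOp (e n) (fun k => √(max (b n k - t) 0)) (u n)‖ ^ 2) := by
      refine hasSum_sum_of_ne_finset_zero fun n hn => ?_
      rw [norm_sq_specOp]
      refine Finset.sum_eq_zero fun k _ => ?_
      rw [max_eq_right (by linarith [hS n hn k])]
      simp
    refine hasSum_le (fun n => ?_) h1 (h2.add h3)
    rw [hdn]
    exact re_inner_specOp_le _ _ _ _
  rw [hQ, inner_add_right, inner_sub_right, inner_smul_right, huu, ← Complex.ofReal_mul]
  simp only [Complex.add_re, Complex.sub_re, Complex.ofReal_re]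
  linarith

/-- The sharp bound for the sum of `√(E² - 4)` over the eigenvalues `E > 2` after subtracting
a level `t` from the potential. -/
theorem sum_sqrt_le_sum_max {e : ℤ → OrthonormalBasis (Fin m) ℂ (EuclideanSpace ℂ (Fin m))}
    {b : ℤ → Fin m → ℝ} {ι : Type*} [Fintype ι] {v : ι → EllTwo m} (hv : Orthonormal ℂ v)
    {lam : ι → ℝ}
    (heq : ∀ i n, v i (n - 1) + v i (n + 1) + specOp (e n) (b n) (v i n) = (lam i : ℂ) • v i n)
    {t : ℝ} {S : Finset ℤ} (hS : ∀ n ∉ S, ∀ k, b n k ≤ t) (hlam : ∀ i, 2 < lam i - t) :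
    ∑ i, √((lam i - t) ^ 2 - 4) ≤ ∑ n ∈ S, ∑ k, max (b n k - t) 0 := by
  have hJ i := joukowskyInv_spec (hlam i)
  have key := sum_inv_sub_le_trace (S := S)
    (C := fun n => specOp (e n) (fun k => √(max (b n k - t) 0)))
    (fun n => specOp_isSymmetric _ _) (a := fun i => joukowskyInv (lam i - t))
    (fun i => (hJ i).1) (fun i => (hJ i).2.1) hv.linearIndependent (fun i c hc => by
      rw [(hJ i).2.2.1]
      refine truncated_form_le hv heq hS c fun j hj => ?_
      have := le_of_joukowskyInv_le (hlam j) (hlam i) (hc j hj)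
      linarith) e
  simp only [norm_sq_specOp_sqrt_basis] at key
  refine le_trans (Finset.sum_le_sum fun i _ => ?_) key
  exact (hJ i).2.2.2.ge

end Truncation

end

/-! ### Lifting the moments -/

section Moments

open MeasureTheory

/-- The integrals over `t` are taken in `ℝ≥0∞` over a fixed half-line, so that sums and integrals
interchange freely; `ENNReal.ofReal` discards the range beyond `L`. -/
theorem lintegral_rpow_mul_eq {q L : ℝ} (hq : -1 < q) (hL : 0 ≤ L) {f : ℝ → ℝ}
    (hf : ContinuousOn f (Set.Icc 0 L)) (hpos : ∀ t ∈ Set.Ioc 0 L, 0 ≤ f t)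
    (hneg : ∀ t, L < t → f t ≤ 0) :
    ∫⁻ t in Set.Ioi (0 : ℝ), ENNReal.ofReal (t ^ q) * ENNReal.ofReal (f t) =
      ENNReal.ofReal (∫ t in (0 : ℝ)..L, t ^ q * f t) := by
  have hint : IntervalIntegrable (fun t => t ^ q * f t) volume 0 L :=
    (intervalIntegral.intervalIntegrable_rpow' hq).mul_continuousOn (by rwa [Set.uIcc_of_le hL])
  rw [intervalIntegral.integral_of_le hL, ofReal_integral_eq_lintegral_ofReal
    ((intervalIntegrable_iff_integrableOn_Ioc_of_le hL).mp hint)]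
  · symm
    calc ∫⁻ t in Set.Ioc 0 L, ENNReal.ofReal (t ^ q * f t)
        = ∫⁻ t in Set.Ioc 0 L, ENNReal.ofReal (t ^ q) * ENNReal.ofReal (f t) := by
          refine setLIntegral_congr_fun measurableSet_Ioc fun t ht => ?_
          exact ENNReal.ofReal_mul (Real.rpow_nonneg ht.1.le _)
      _ = _ := by
          have h0 : ∫⁻ t in Set.Ioi L, ENNReal.ofReal (t ^ q) * ENNReal.ofReal (f t) = 0 := by
            refine setLIntegral_eq_zero measurableSet_Ioi fun t ht => ?_
            rw [ENNReal.ofReal_of_nonpos (hneg t ht), mul_zero, Pi.zero_apply]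
          rw [← Set.Ioc_union_Ioi_eq_Ioi hL, lintegral_union measurableSet_Ioi
            (Set.Ioc_disjoint_Ioi le_rfl), h0, add_zero]
  · refine (ae_restrict_iff' measurableSet_Ioc).mpr (.of_forall fun t ht => ?_)
    exact mul_nonneg (Real.rpow_nonneg ht.1.le _) (hpos t ht)

theorem GFun_eq_integral (γ x : ℝ) :
    GFun γ x = ∫ t in (0 : ℝ)..(x - 2), t ^ (γ - 3 / 2) * √((x - t) ^ 2 - 4) := by
  have h := intervalIntegral.integral_comp_sub_left (a := 0) (b := x - 2)
    (fun E => (E ^ 2 - 4) ^ (1 / 2 : ℝ) * (x - E) ^ (γ - 3 / 2)) x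
  rw [sub_zero, sub_sub_cancel] at h
  rw [GFun, ← h]
  refine intervalIntegral.integral_congr fun t _ => ?_
  simp only [sub_sub_cancel]
  rw [Real.sqrt_eq_rpow, mul_comm]

theorem lintegral_rpow_mul_sqrt {γ x : ℝ} (hγ : 1 / 2 < γ) (hx : 2 < x) :
    ∫⁻ t in Set.Ioi (0 : ℝ), ENNReal.ofReal (t ^ (γ - 3 / 2)) *
        ENNReal.ofReal (if 2 < x - t then √((x - t) ^ 2 - 4) else 0) =
      ENNReal.ofReal (GFun γ x) := by
  -- The condition `2 < x - t` matters: the square root becomes positive again once `x - t < -2`.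
  have heq : Set.EqOn (fun t : ℝ => if 2 < x - t then √((x - t) ^ 2 - 4) else 0)
      (fun t => √((x - t) ^ 2 - 4)) (Set.Icc 0 (x - 2)) := by
    intro t ht
    simp only
    split_ifs with h
    · rfl
    · have : t = x - 2 := le_antisymm ht.2 (by linarith)
      rw [this]; norm_num
  rw [lintegral_rpow_mul_eq (by linarith) (L := x - 2) (by linarith)
    (ContinuousOn.congr (by fun_prop) heq), GFun_eq_integral]
  · congr 1
    refine intervalIntegral.integral_congr fun t ht => ?_
    rw [Set.uIcc_of_le (by linarith)] at ht
    exact congrArg _ (heq ht)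
  · intro t _
    split_ifs <;> positivity
  · intro t ht
    rw [if_neg (by linarith)]

theorem beta_two {s : ℝ} (hs : 0 < s) : ProbabilityTheory.beta s 2 = 1 / (s * (s + 1)) := by
  rw [ProbabilityTheory.beta, show s + 2 = (s + 1) + 1 by ring, Real.Gamma_add_one (by positivity),
    Real.Gamma_add_one hs.ne', Real.Gamma_two]
  have := (Real.Gamma_pos_of_pos hs).ne'
  field_simp

theorem lintegral_rpow_mul_sub {γ : ℝ} (hγ : 1 / 2 < γ) (b : ℝ) :
    ∫⁻ t in Set.Ioi (0 : ℝ), ENNReal.ofReal (t ^ (γ - 3 / 2)) * ENNReal.ofReal (max (b - t) 0) =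
      ENNReal.ofReal (ProbabilityTheory.beta (γ - 1 / 2) 2 * max b 0 ^ (γ + 1 / 2)) := by
  rw [lintegral_rpow_mul_eq (by linarith) (L := max b 0) (le_max_right _ _) (by fun_prop)
    (fun _ _ => le_max_right _ _) (fun t ht => by
      rw [max_eq_right]
      linarith [le_max_left b 0])]
  congr 1
  rcases le_or_gt b 0 with hb | hb
  · rw [max_eq_right hb, Real.zero_rpow (by linarith)]
    simp
  · rw [max_eq_left hb.le]
    have h1 : ∫ t in (0 : ℝ)..b, t ^ (γ - 3 / 2) * max (b - t) 0 =
        ∫ t in (0 : ℝ)..b, (b * t ^ (γ - 3 / 2) - t ^ (γ - 3 / 2 + 1)) := by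
      refine intervalIntegral.integral_congr fun t ht => ?_
      rw [Set.uIcc_of_le hb.le] at ht
      rw [max_eq_left (by linarith [ht.2]), Real.rpow_add_one' ht.1 (by linarith)]
      ring
    rw [h1, intervalIntegral.integral_sub
      ((intervalIntegral.intervalIntegrable_rpow' (by linarith)).const_mul b)
      (intervalIntegral.intervalIntegrable_rpow' (by linarith)),
      intervalIntegral.integral_const_mul, integral_rpow (Or.inl (by linarith)),
      integral_rpow (Or.inl (by linarith)), Real.zero_rpow (by linarith),
      Real.zero_rpow (by linarith), beta_two (by linarith)]
    have e1 : b ^ (γ + 1 / 2) = b * b ^ (γ - 3 / 2 + 1) := by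
      rw [show γ + 1 / 2 = (γ - 3 / 2 + 1) + 1 by ring, Real.rpow_add_one hb.ne', mul_comm]
    have e2 : b ^ (γ - 3 / 2 + 1 + 1) = b * b ^ (γ - 3 / 2 + 1) := by
      rw [Real.rpow_add_one hb.ne', mul_comm]
    rw [e1, e2]
    obtain ⟨s, hs, hs'⟩ : ∃ s : ℝ, 0 < s ∧ γ = s + 1 / 2 := ⟨γ - 1 / 2, by linarith, by ring⟩
    subst hs'
    rw [show s + 1 / 2 - 3 / 2 + 1 = s by ring, show s + 1 / 2 - 1 / 2 = s by ring]
    field_simp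
    ring

variable {m : ℕ}

/-- Summability forces the eigenvalues of the potential to tend to `0`, so cutting at any positive
level leaves finitely many sites. -/
theorem finite_setOf_lt_of_summable {p : ℝ} (hp : 0 < p) {b : ℤ → Fin m → ℝ}
    (hb : Summable fun n => ∑ k, |b n k| ^ p) {t : ℝ} (ht : 0 < t) :
    ∃ S : Finset ℤ, ∀ n ∉ S, ∀ k, b n k ≤ t := by
  have h := hb.tendsto_cofinite_zero.eventually_lt_const (Real.rpow_pos_of_pos ht p)
  refine ⟨(Filter.eventually_cofinite.mp h).toFinset, fun n hn k => ?_⟩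
  have hn' : ∑ k, |b n k| ^ p < t ^ p := by simpa using hn
  have h1 : |b n k| ^ p ≤ ∑ k, |b n k| ^ p :=
    Finset.single_le_sum (f := fun k => |b n k| ^ p) (fun k _ => by positivity) (Finset.mem_univ k)
  have h2 := (Real.rpow_lt_rpow_iff (abs_nonneg _) ht.le hp).mp (h1.trans_lt hn')
  exact (le_abs_self _).trans h2.le

theorem GFun_nonneg (γ : ℝ) {x : ℝ} (hx : 2 ≤ x) : 0 ≤ GFun γ x := by
  rw [GFun_eq_integral]
  exact intervalIntegral.integral_nonneg (by linarith) fun t ht =>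
    mul_nonneg (Real.rpow_nonneg ht.1 _) (Real.sqrt_nonneg _)

theorem sum_GFun_le {e : ℤ → OrthonormalBasis (Fin m) ℂ (EuclideanSpace ℂ (Fin m))}
    {b : ℤ → Fin m → ℝ} {ι : Type*} [Fintype ι] {v : ι → EllTwo m} (hv : Orthonormal ℂ v)
    {lam : ι → ℝ}
    (heq : ∀ i n, v i (n - 1) + v i (n + 1) + specOp (e n) (b n) (v i n) = (lam i : ℂ) • v i n)
    (hlam : ∀ i, 2 < lam i) {γ : ℝ} (hγ : 1 / 2 < γ)
    (hb : Summable fun n => ∑ k, |b n k| ^ (γ + 1 / 2)) :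
    ∑ i, GFun γ (lam i) ≤ ProbabilityTheory.beta (γ - 1 / 2) 2 *
      ∑' n, ∑ k, max (b n k) 0 ^ (γ + 1 / 2) := by
  have hbeta : 0 ≤ ProbabilityTheory.beta (γ - 1 / 2) 2 :=
    (ProbabilityTheory.beta_pos (by linarith) two_pos).le
  have hsum : Summable fun n => ProbabilityTheory.beta (γ - 1 / 2) 2 *
      ∑ k, max (b n k) 0 ^ (γ + 1 / 2) := by
    refine Summable.mul_left _ (Summable.of_nonneg_of_le (fun n => by positivity) (fun n => ?_) hb)
    refine Finset.sum_le_sum fun k _ => ?_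
    exact Real.rpow_le_rpow (le_max_right _ _) (max_le (le_abs_self _) (abs_nonneg _))
      (by linarith)
  rw [← tsum_mul_left, ← ENNReal.ofReal_le_ofReal_iff (tsum_nonneg fun n => by positivity),
    ENNReal.ofReal_sum_of_nonneg fun i _ => GFun_nonneg γ (hlam i).le,
    ENNReal.ofReal_tsum_of_nonneg (fun n => by positivity) hsum]
  simp only [Finset.mul_sum]
  have hR (n : ℤ) : ENNReal.ofReal (∑ k, ProbabilityTheory.beta (γ - 1 / 2) 2 *
      max (b n k) 0 ^ (γ + 1 / 2)) = ∫⁻ t in Set.Ioi (0 : ℝ), ∑ k,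
        ENNReal.ofReal (t ^ (γ - 3 / 2)) * ENNReal.ofReal (max (b n k - t) 0) := by
    rw [lintegral_finsetSum _ (fun k _ => by fun_prop),
      ENNReal.ofReal_sum_of_nonneg fun k _ => by positivity]
    simp only [lintegral_rpow_mul_sub hγ]
  have hM (x : ℝ) : Measurable fun t : ℝ => ENNReal.ofReal (t ^ (γ - 3 / 2)) *
        ENNReal.ofReal (if 2 < x - t then √((x - t) ^ 2 - 4) else 0) := by
    refine Measurable.mul (by fun_prop) (Measurable.ennreal_ofReal (Measurable.ite ?_ ?_ ?_))
    · exact measurableSet_lt (by fun_prop) (by fun_prop)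
    · fun_prop
    · fun_prop
  simp only [hR]
  rw [← lintegral_tsum (fun n => by fun_prop)]
  simp only [← lintegral_rpow_mul_sqrt hγ (hlam _)]
  rw [← lintegral_finsetSum _ fun i _ => hM _]
  refine setLIntegral_mono' measurableSet_Ioi fun t ht => ?_
  simp only [← Finset.mul_sum]
  rw [ENNReal.tsum_mul_left]
  gcongr
  obtain ⟨S, hS⟩ := finite_setOf_lt_of_summable (by linarith) hb ht
  -- For fixed `t`, only eigenvalues still above `2` after the shift by `t` contribute.
  have key := sum_sqrt_le_sum_max (ι := {i // 2 < lam i - t})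
    (hv.comp (fun i : {i // 2 < lam i - t} => i.1) Subtype.val_injective)
    (lam := fun i => lam i.1) (fun i n => heq i.1 n) hS (fun i => i.2)
  calc ∑ i, ENNReal.ofReal (if 2 < lam i - t then √((lam i - t) ^ 2 - 4) else 0)
      = ENNReal.ofReal (∑ i, if 2 < lam i - t then √((lam i - t) ^ 2 - 4) else 0) :=
        (ENNReal.ofReal_sum_of_nonneg fun i _ => by split_ifs <;> positivity).symm
    _ ≤ ENNReal.ofReal (∑ n ∈ S, ∑ k, max (b n k - t) 0) := by
        refine ENNReal.ofReal_le_ofReal (le_trans (le_of_eq ?_) key)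
        rw [← Finset.sum_filter]
        exact Finset.sum_subtype _ (by simp) _
    _ = ∑ n ∈ S, ∑ k, ENNReal.ofReal (max (b n k - t) 0) := by
        rw [ENNReal.ofReal_sum_of_nonneg fun n _ => Finset.sum_nonneg fun k _ => le_max_right _ _]
        exact Finset.sum_congr rfl fun n _ =>
          ENNReal.ofReal_sum_of_nonneg fun k _ => le_max_right _ _
    _ ≤ _ := ENNReal.sum_le_tsum S

end Moments

/-! ### The discrete Schrödinger operator -/

section Schrodinger

variable {m : ℕ}

theorem matAct_eq_specOp {M : Matrix (Fin m) (Fin m) ℂ} (hM : M.IsHermitian)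
    (u : EuclideanSpace ℂ (Fin m)) :
    matAct M u = specOp hM.eigenvectorBasis hM.eigenvalues u := by
  have h : (matAct M : EuclideanSpace ℂ (Fin m) →ₗ[ℂ] EuclideanSpace ℂ (Fin m)) =
      specOp hM.eigenvectorBasis hM.eigenvalues := by
    refine hM.eigenvectorBasis.toBasis.ext fun k => ?_
    rw [OrthonormalBasis.coe_toBasis, specOp_basis]
    apply (WithLp.ofLp_injective 2)
    have := hM.mulVec_eigenvectorBasis k
    rw [ContinuousLinearMap.coe_coe, Matrix.ofLp_toEuclideanCLM, this]
    rfl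
  exact LinearMap.congr_fun h u

theorem specOp_neg (e : OrthonormalBasis (Fin m) ℂ (EuclideanSpace ℂ (Fin m))) (c : Fin m → ℝ)
    (u : EuclideanSpace ℂ (Fin m)) : specOp e (fun k => -c k) u = -specOp e c u := by
  simp [specOp_apply]

theorem trace_cfc_re {M : Matrix (Fin m) (Fin m) ℂ} (hM : M.IsHermitian) (f : ℝ → ℝ) :
    (cfc f M).trace.re = ∑ k, f (hM.eigenvalues k) := by
  rw [hM.cfc_eq, Matrix.IsHermitian.cfc, Unitary.conjStarAlgAut_apply, Matrix.trace_mul_comm,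
    ← mul_assoc, Unitary.coe_star_mul_self, one_mul, Matrix.trace_diagonal, Complex.re_sum]
  rfl

theorem trAbsPow_eq_sum {M : Matrix (Fin m) (Fin m) ℂ} (hM : M.IsHermitian) (p : ℝ) :
    trAbsPow M p = ∑ k, |hM.eigenvalues k| ^ p :=
  trace_cfc_re hM _

theorem trAbsPow_two {M : Matrix (Fin m) (Fin m) ℂ} (hM : M.IsHermitian) :
    trAbsPow M 2 = (M ^ 2).trace.re := by
  have hM' : IsSelfAdjoint M := hM
  rw [trAbsPow]
  simp only [Real.rpow_ofNat, sq_abs]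
  rw [cfc_pow_id M 2]

namespace MatrixJacobi

variable {W : MatrixJacobi m}

theorem op_apply_of_isDiscreteSchrodinger (hW : W.IsDiscreteSchrodinger) (u : EllTwo m) (n : ℤ) :
    W.op u n = -u (n - 1) - u (n + 1) + matAct (W.B n) (u n) := by
  have h : W.op u n = matAct (W.A (n - 1))ᴴ (u (n - 1)) + matAct (W.A n) (u (n + 1))
        + matAct (W.B n) (u n) := rfl
  rw [h, hW, hW]
  simp [matAct, sub_eq_add_neg]

theorem inner_matAct_B (n : ℤ) (x y : EuclideanSpace ℂ (Fin m)) :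
    inner ℂ (matAct (W.B n) x) y = inner ℂ x (matAct (W.B n) y) := by
  rw [matAct_eq_specOp (W.isHermitian_B n), matAct_eq_specOp (W.isHermitian_B n)]
  exact specOp_isSymmetric _ _ x y

theorem op_isSymmetric (hW : W.IsDiscreteSchrodinger) : W.op.IsSymmetric := by
  intro u v
  have h (x : EllTwo m) : ∃ y : EllTwo m, (∀ n, y n = matAct (W.B n) (x n)) ∧
      W.op x = y - latticeShift 1 x - latticeShift (-1) x := by
    refine ⟨W.op x + latticeShift 1 x + latticeShift (-1) x, fun n => ?_, by abel⟩
    simp only [lp.coeFn_add, Pi.add_apply, latticeShift_apply,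
      op_apply_of_isDiscreteSchrodinger hW, ← sub_eq_add_neg]
    abel
  obtain ⟨y, hy, hu⟩ := h u
  obtain ⟨z, hz, hv⟩ := h v
  have hyz : inner ℂ y v = inner ℂ u z := by
    rw [lp.inner_eq_tsum, lp.inner_eq_tsum]
    refine tsum_congr fun n => ?_
    rw [hy, hz, inner_matAct_B]
  rw [hu, hv]
  simp only [inner_sub_left, inner_sub_right, inner_latticeShift_left, neg_neg, hyz]
  ring

theorem eigenvector_recurrence (hW : W.IsDiscreteSchrodinger) {x : ℝ} {u : EllTwo m}
    (hu : u ∈ Module.End.eigenspace W.op (x : ℂ)) (n : ℤ) :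
    -u (n - 1) - u (n + 1) + matAct (W.B n) (u n) = (x : ℂ) • u n := by
  rw [← op_apply_of_isDiscreteSchrodinger hW, Module.End.mem_eigenspace_iff.mp hu]
  rfl

/-- The Wronskian is independent of the site because `B(n)` is Hermitian and `x` is real, and it
tends to `0` because both solutions are square-summable. -/
theorem wronskian_eq_zero (hW : W.IsDiscreteSchrodinger) {x : ℝ} {u v : EllTwo m}
    (hu : u ∈ Module.End.eigenspace W.op (x : ℂ)) (hv : v ∈ Module.End.eigenspace W.op (x : ℂ)) :
    inner ℂ (u 0) (v 1) - inner ℂ (u 1) (v 0) = 0 := by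
  have hstep (n : ℤ) : inner ℂ (u n) (v (n + 1)) - inner ℂ (u (n + 1)) (v n) =
      inner ℂ (u (n - 1)) (v n) - inner ℂ (u n) (v (n - 1)) := by
    have e1 : v (n + 1) = -v (n - 1) + matAct (W.B n) (v n) - (x : ℂ) • v n := by
      rw [← eigenvector_recurrence hW hv n]; abel
    have e2 : u (n + 1) = -u (n - 1) + matAct (W.B n) (u n) - (x : ℂ) • u n := by
      rw [← eigenvector_recurrence hW hu n]; abel
    rw [e1, e2]
    simp only [inner_sub_left, inner_sub_right, inner_add_left, inner_add_right, inner_neg_left,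
      inner_neg_right, inner_smul_left, inner_smul_right, Complex.conj_ofReal, inner_matAct_B]
    ring
  have hconst (n : ℕ) : inner ℂ (u n) (v (n + 1)) - inner ℂ (u (n + 1)) (v n) =
      inner ℂ (u 0) (v 1) - inner ℂ (u 1) (v 0) := by
    induction n with
    | zero => simp
    | succ n ih =>
      rw [← ih]
      have := hstep (n + 1)
      rw [add_sub_cancel_right] at this
      exact_mod_cast this
  have h1 : Summable fun n : ℤ => (inner ℂ (u n) (v (n + 1)) : ℂ) :=
    lp.summable_inner (𝕜 := ℂ) u (latticeShift 1 v)
  have h2 : Summable fun n : ℤ => (inner ℂ (u (n + 1)) (v n) : ℂ) :=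
    lp.summable_inner (𝕜 := ℂ) (latticeShift 1 u) v
  have hlim : Filter.Tendsto (fun n : ℤ => inner ℂ (u n) (v (n + 1)) - inner ℂ (u (n + 1)) (v n))
      Filter.cofinite (𝓝 (0 - 0)) :=
    h1.tendsto_cofinite_zero.sub h2.tendsto_cofinite_zero
  have hlim' := hlim.comp (Nat.cast_injective (R := ℤ)).tendsto_cofinite
  rw [sub_zero] at hlim'
  refine tendsto_nhds_unique (tendsto_const_nhds.congr fun n => ?_) hlim'
  exact (hconst n).symm

theorem eq_zero_of_eigenvector (hW : W.IsDiscreteSchrodinger) {x : ℝ} {u : EllTwo m}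
    (hu : u ∈ Module.End.eigenspace W.op (x : ℂ)) (h0 : u 0 = 0) (h1 : u 1 = 0) : u = 0 := by
  have hup (n : ℕ) : u n = 0 ∧ u (n + 1) = 0 := by
    induction n with
    | zero => exact ⟨h0, by simpa using h1⟩
    | succ n ih =>
      have := eigenvector_recurrence hW hu (n + 1)
      rw [add_sub_cancel_right, ih.1, ih.2] at this
      push_cast
      exact ⟨ih.2, by simpa using this⟩
  have hdown (n : ℕ) : u (-n) = 0 ∧ u (-n + 1) = 0 := by
    induction n with
    | zero => exact ⟨by simpa using h0, by simpa using h1⟩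
    | succ n ih =>
      have := eigenvector_recurrence hW hu (-n)
      rw [ih.1, ih.2] at this
      push_cast
      rw [neg_add, ← sub_eq_add_neg, sub_add_cancel]
      exact ⟨by simpa using this, ih.1⟩
  ext1
  funext n
  obtain ⟨k, rfl | rfl⟩ := n.eq_nat_or_neg
  · exact (hup k).1
  · exact (hdown k).1

/-- The data `(u(0), u(1))` embed the eigenspace in `ℂ^(2m)`. Vanishing Wronskians make the image
`L` isotropic: `J L` is orthogonal to `L` for the injective `J`, so `2 dim L ≤ 2m`. -/
theorem rank_eigenspace_le (hW : W.IsDiscreteSchrodinger) (x : ℝ) :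
    Module.rank ℂ (Module.End.eigenspace W.op (x : ℂ)) ≤ (m : Cardinal) := by
  let V := EuclideanSpace ℂ (Fin m)
  let P := WithLp 2 (V × V)
  let Φ : Module.End.eigenspace W.op (x : ℂ) →ₗ[ℂ] P :=
    { toFun := fun u => WithLp.toLp 2 (u.1 0, u.1 1)
      map_add' := fun _ _ => rfl
      map_smul' := fun _ _ => rfl }
  let J : P →ₗ[ℂ] P :=
    { toFun := fun p => WithLp.toLp 2 (-p.snd, p.fst)
      map_add' := fun p q => by
        apply WithLp.ofLp_injective
        ext1
        · exact neg_add _ _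
        · rfl
      map_smul' := fun c p => by
        apply WithLp.ofLp_injective
        ext1
        · exact (smul_neg c p.snd).symm
        · rfl }
  have hJ : Function.Injective J := by
    intro p q h
    have h' := congrArg (WithLp.ofLp) h
    apply WithLp.ofLp_injective
    ext1
    · exact congrArg Prod.snd h'
    · exact neg_injective (congrArg Prod.fst h')
  have hΦ : Function.Injective Φ := by
    rw [injective_iff_map_eq_zero]
    intro u hu
    have h' := congrArg (WithLp.ofLp) hu
    exact Subtype.ext (eq_zero_of_eigenvector hW u.2 (congrArg Prod.fst h') (congrArg Prod.snd h'))
  have hle : (LinearMap.range Φ).map J ≤ (LinearMap.range Φ)ᗮ := by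
    rintro _ ⟨_, ⟨v, rfl⟩, rfl⟩
    rw [Submodule.mem_orthogonal]
    rintro _ ⟨u, rfl⟩
    have := wronskian_eq_zero hW u.2 v.2
    rw [WithLp.prod_inner_apply]
    change inner ℂ (u.1 0) (-(v.1 1)) + inner ℂ (u.1 1) (v.1 0) = 0
    rw [inner_neg_right]
    linear_combination -this
  have hP : Module.finrank ℂ P = m + m := by
    rw [(WithLp.linearEquiv 2 ℂ (V × V)).finrank_eq, Module.finrank_prod, finrank_euclideanSpace_fin]
  have h1 := Submodule.finrank_mono hle
  rw [← (Submodule.equivMapOfInjective J hJ (LinearMap.range Φ)).finrank_eq] at h1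
  have h2 := (LinearMap.range Φ).finrank_add_finrank_orthogonal
  rw [hP] at h2
  rw [(LinearEquiv.ofInjective Φ hΦ).rank_eq, ← Module.finrank_eq_rank]
  exact_mod_cast (by omega : Module.finrank ℂ (LinearMap.range Φ) ≤ m)

/-- The one-sided eigenvalue bound; `σ = 1` concerns the eigenvalues above `2` and `σ = -1` those
below `-2`. -/
theorem sum_multiplicity_mul_GFun_le (hW : W.IsDiscreteSchrodinger) (σ : ℤˣ) (T : Finset ℝ)
    (hT : ∀ x ∈ T, 2 < ((σ : ℤ) : ℝ) * x) {γ : ℝ} (hγ : 1 / 2 < γ)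
    (hB : Summable fun n : ℤ => trAbsPow (W.B n) (γ + 1 / 2)) :
    ∑ x ∈ T, (W.multiplicity x : ℝ) * GFun γ |x| ≤ ProbabilityTheory.beta (γ - 1 / 2) 2 *
      ∑' n, ∑ k, max (((σ : ℤ) : ℝ) * (W.isHermitian_B n).eigenvalues k) 0 ^ (γ + 1 / 2) := by
  -- For `σ = 1` the signs alternate and turn `-T - T⁻¹` into `T + T⁻¹`. For `σ = -1` they are
  -- constant and the equation is that of `-W`. In both cases the potential is `σ B` and the
  -- eigenvalue `σ x`.
  obtain ⟨ε, hε⟩ : ∃ ε : ℤ → ℤˣ, ∀ n, ε (n + 1) = -σ * ε n := by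
    refine ⟨fun n => (-σ) ^ n, fun n => ?_⟩
    change (-σ) ^ (n + 1) = -σ * (-σ) ^ n
    rw [zpow_add_one, mul_comm]
  have hε' (n : ℤ) : ε (n - 1) = -σ * ε n := by
    have := hε (n - 1)
    rw [sub_add_cancel] at this
    rw [this, ← mul_assoc, neg_mul_neg, Int.units_mul_self, one_mul]
  have hfin (x : ℝ) : FiniteDimensional ℂ (Module.End.eigenspace W.op (x : ℂ)) :=
    Module.rank_lt_aleph0_iff.mp ((rank_eigenspace_le hW x).trans_lt (Cardinal.natCast_lt_aleph0))
  let w (x : T) := stdOrthonormalBasis ℂ (Module.End.eigenspace W.op ((x : ℝ) : ℂ))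
  let u (i : Σ x : T, Fin (Module.finrank ℂ (Module.End.eigenspace W.op ((x : ℝ) : ℂ)))) :
      EllTwo m := w i.1 i.2
  have hfam : OrthogonalFamily ℂ
      (fun x : T => Module.End.eigenspace W.op ((x : ℝ) : ℂ))
      (fun x => (Module.End.eigenspace W.op ((x : ℝ) : ℂ)).subtypeₗᵢ) :=
    (op_isSymmetric hW).orthogonalFamily_eigenspaces.comp
      (f := fun x : T => ((x : ℝ) : ℂ)) (Complex.ofReal_injective.comp Subtype.val_injective)
  have hu : Orthonormal ℂ u :=
    hfam.orthonormal_sigma_orthonormal (v_family := fun x => w x) (fun x => (w x).orthonormal)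
  have hmem (i) : u i ∈ Module.End.eigenspace W.op ((i.1 : ℝ) : ℂ) := Subtype.mem _
  have hB' : Summable fun n : ℤ =>
      ∑ k, |((σ : ℤ) : ℝ) * (W.isHermitian_B n).eigenvalues k| ^ (γ + 1 / 2) := by
    refine hB.congr fun n => ?_
    rw [trAbsPow_eq_sum (W.isHermitian_B n)]
    refine Finset.sum_congr rfl fun k _ => ?_
    rcases Int.units_eq_one_or σ with rfl | rfl <;> simp
  have key := sum_GFun_le (e := fun n => (W.isHermitian_B n).eigenvectorBasis)
    (b := fun n k => ((σ : ℤ) : ℝ) * (W.isHermitian_B n).eigenvalues k)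
    (hu.comp_linearIsometry (signFlip ε)) (lam := fun i => ((σ : ℤ) : ℝ) * (i.1 : ℝ)) (fun i n => by
      have h1 := eigenvector_recurrence hW (hmem i) n
      rw [matAct_eq_specOp (W.isHermitian_B n)] at h1
      simp only [Function.comp_apply, signFlip_apply, map_smul, hε, hε']
      rcases Int.units_eq_one_or σ with rfl | rfl
      · simp only [Units.val_neg, Units.val_one, neg_mul, one_mul, Int.cast_neg, Int.cast_one]
        rw [smul_comm, ← h1]
        module
      · simp only [Units.val_neg, Units.val_one, neg_mul, one_mul, Int.cast_neg, Int.cast_one,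
          neg_neg, specOp_neg, Complex.ofReal_neg, neg_smul]
        rw [smul_comm, ← h1]
        module) (fun i => hT _ i.1.2) hγ hB'
  refine le_trans (le_of_eq ?_) key
  rw [Fintype.sum_sigma, ← Finset.sum_coe_sort]
  refine Finset.sum_congr rfl fun x _ => ?_
  have habs : |(x : ℝ)| = ((σ : ℤ) : ℝ) * x := by
    have := hT x x.2
    rcases Int.units_eq_one_or σ with rfl | rfl
    · simp only [Units.val_one, Int.cast_one, one_mul] at this ⊢
      exact abs_of_pos (by linarith)
    · simp only [Units.val_neg, Units.val_one, Int.cast_neg, Int.cast_one, neg_mul, one_mul] at this ⊢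
      exact abs_of_neg (by linarith)
  simp [habs, multiplicity]

end MatrixJacobi

end Schrodinger

/-! ### Closed forms of `G_γ` -/

section ClosedForms

open MeasureTheory

/-- Substitute `E = s + 1/s`: then `√(E² - 4) = s - 1/s` and `dE = (1 - 1/s²) ds`, so the integrand
is rational. -/
theorem GFun_joukowsky (p : ℕ) {κ : ℝ} (hκ : 1 ≤ κ) :
    GFun (p + 3 / 2) (κ + 1 / κ) =
      ∫ s in (1 : ℝ)..κ, (κ + 1 / κ - (s + s⁻¹)) ^ p * (s - 2 / s + 1 / s ^ 3) := by
  set x := κ + 1 / κ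
  have hpos : ∀ s ∈ Set.uIcc 1 κ, 1 ≤ s := fun s hs => by
    rw [Set.uIcc_of_le hκ] at hs; exact hs.1
  have hder : ∀ s ∈ Set.uIcc 1 κ, HasDerivAt (fun s : ℝ => s + s⁻¹) (1 - (s ^ 2)⁻¹) s := by
    intro s hs
    have := (hasDerivAt_id s).add (hasDerivAt_inv (x := s) (by linarith [hpos s hs]))
    exact this
  have hcont : ContinuousOn (fun s : ℝ => 1 - (s ^ 2)⁻¹) (Set.uIcc 1 κ) :=
    ContinuousOn.sub continuousOn_const (ContinuousOn.inv₀ (by fun_prop) fun s hs => by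
      have := hpos s hs; positivity)
  have h := intervalIntegral.integral_comp_mul_deriv hder hcont
    (g := fun E => √(E ^ 2 - 4) * (x - E) ^ p) (by fun_prop)
  have hx : x = κ + κ⁻¹ := by rw [← one_div]
  have hG : GFun (p + 3 / 2) x = ∫ E in (2 : ℝ)..x, √(E ^ 2 - 4) * (x - E) ^ p := by
    refine intervalIntegral.integral_congr fun E _ => ?_
    simp only [add_sub_cancel_right, Real.rpow_natCast, Real.sqrt_eq_rpow]
  rw [show (1 : ℝ) + 1⁻¹ = 2 by norm_num, ← hx, ← hG] at h
  rw [← h]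
  refine intervalIntegral.integral_congr fun s hs => ?_
  have hs1 := hpos s hs
  have hs0 : 0 < s := by linarith
  have hsq : √((s + s⁻¹) ^ 2 - 4) = s - s⁻¹ := by
    rw [show (s + s⁻¹) ^ 2 - 4 = (s - s⁻¹) ^ 2 by field_simp; ring]
    exact Real.sqrt_sq (by linarith [inv_le_one_of_one_le₀ hs1])
  simp only [Function.comp_apply, hsq]
  field_simp
  ring

theorem GFun_joukowsky_eq_sub (p : ℕ) {κ : ℝ} (hκ : 1 ≤ κ) {F : ℝ → ℝ}
    (hF : ∀ s, 0 < s →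
      HasDerivAt F ((κ + 1 / κ - (s + s⁻¹)) ^ p * (s - 2 / s + 1 / s ^ 3)) s) :
    GFun (p + 3 / 2) (κ + 1 / κ) = F κ - F 1 := by
  rw [GFun_joukowsky p hκ]
  have hpos : ∀ s ∈ Set.uIcc 1 κ, 0 < s := fun s hs => by
    rw [Set.uIcc_of_le hκ] at hs; linarith [hs.1]
  refine intervalIntegral.integral_eq_sub_of_hasDerivAt (fun s hs => hF s (hpos s hs)) ?_
  refine ContinuousOn.intervalIntegrable ?_
  refine ContinuousOn.mul (ContinuousOn.pow (ContinuousOn.sub continuousOn_const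
    (continuousOn_id.add (continuousOn_id.inv₀ fun s hs => (hpos s hs).ne'))) p)
    (ContinuousOn.add (continuousOn_id.sub (continuousOn_const.div continuousOn_id fun s hs =>
      (hpos s hs).ne')) (continuousOn_const.div (by fun_prop) fun s hs => ?_))
  have := hpos s hs
  positivity

theorem hasDerivAt_inv_pow (n : ℕ) {s : ℝ} (hs : s ≠ 0) :
    HasDerivAt (fun s : ℝ => (s ^ n)⁻¹) (-(n * s ^ (n - 1)) / (s ^ n) ^ 2) s :=
  (hasDerivAt_pow n s).inv (pow_ne_zero n hs)

/-- Expanding `(κ + 1/κ - (s + 1/s))^p` binomially for `p ≤ 2` requires primitives of `(s + 1/s)^j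
(s - 2/s + 1/s³)` for `j = 0, 1, 2` only. -/
theorem hasDerivAt_joukowsky_moment_zero {s : ℝ} (hs : s ≠ 0) :
    HasDerivAt (fun s : ℝ => s ^ 2 / 2 - 2 * Real.log s - (s ^ 2)⁻¹ / 2)
      (s - 2 / s + 1 / s ^ 3) s := by
  have h := (((hasDerivAt_pow 2 s).div_const 2).sub ((Real.hasDerivAt_log hs).const_mul 2)).sub
    ((hasDerivAt_inv_pow 2 hs).div_const 2)
  refine h.congr_deriv ?_
  push_cast
  field_simp
  ring

theorem hasDerivAt_joukowsky_moment_one {s : ℝ} (hs : s ≠ 0) :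
    HasDerivAt (fun s : ℝ => s ^ 3 / 3 - s + s⁻¹ - (s ^ 3)⁻¹ / 3)
      ((s + s⁻¹) * (s - 2 / s + 1 / s ^ 3)) s := by
  have h := ((((hasDerivAt_pow 3 s).div_const 3).sub (hasDerivAt_id s)).add
    (hasDerivAt_inv hs)).sub ((hasDerivAt_inv_pow 3 hs).div_const 3)
  refine h.congr_deriv ?_
  push_cast
  field_simp
  ring

theorem hasDerivAt_joukowsky_moment_two {s : ℝ} (hs : s ≠ 0) :
    HasDerivAt (fun s : ℝ => s ^ 4 / 4 - 2 * Real.log s - (s ^ 4)⁻¹ / 4)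
      ((s + s⁻¹) ^ 2 * (s - 2 / s + 1 / s ^ 3)) s := by
  have h := (((hasDerivAt_pow 4 s).div_const 4).sub ((Real.hasDerivAt_log hs).const_mul 2)).sub
    ((hasDerivAt_inv_pow 4 hs).div_const 4)
  refine h.congr_deriv ?_
  push_cast
  field_simp
  ring

theorem GFun_three_halves {κ : ℝ} (hκ : 1 ≤ κ) :
    GFun (3 / 2) (κ + 1 / κ) = 1 / 2 * (κ ^ 2 - 1 / κ ^ 2 - Real.log (κ ^ 4)) := by
  have h := GFun_joukowsky_eq_sub 0 hκ fun s hs =>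
    (hasDerivAt_joukowsky_moment_zero hs.ne').congr_deriv (by ring)
  rw [Nat.cast_zero, zero_add] at h
  rw [h, Real.log_pow]
  simp only [Real.log_one]
  have : κ ≠ 0 := by positivity
  field_simp
  push_cast
  ring

theorem GFun_five_halves {κ : ℝ} (hκ : 1 ≤ κ) :
    GFun (5 / 2) (κ + 1 / κ) = 3 / 2 * (κ - 1 / κ) + 1 / 6 * (κ ^ 3 - 1 / κ ^ 3)
      - Real.log (κ ^ 2) * (κ + 1 / κ) := by
  have h := GFun_joukowsky_eq_sub 1 hκ fun s hs =>
    (((hasDerivAt_joukowsky_moment_zero hs.ne').const_mul (κ + 1 / κ)).sub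
      (hasDerivAt_joukowsky_moment_one hs.ne')).congr_deriv (by ring)
  rw [Nat.cast_one, show (1 : ℝ) + 3 / 2 = 5 / 2 by norm_num] at h
  rw [h, Real.log_pow]
  simp only [Pi.sub_apply, Real.log_one]
  have : κ ≠ 0 := by positivity
  field_simp
  push_cast
  ring

theorem GFun_seven_halves {κ : ℝ} (hκ : 1 ≤ κ) :
    GFun (7 / 2) (κ + 1 / κ) = 1 / 12 * (κ ^ 4 - 1 / κ ^ 4) + 7 / 3 * (κ ^ 2 - 1 / κ ^ 2)
      - Real.log (κ ^ 2) * (κ ^ 2 + 1 / κ ^ 2) - Real.log (κ ^ 6) := by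
  have h := GFun_joukowsky_eq_sub 2 hκ fun s hs =>
    ((((hasDerivAt_joukowsky_moment_zero hs.ne').const_mul ((κ + 1 / κ) ^ 2)).sub
      ((hasDerivAt_joukowsky_moment_one hs.ne').const_mul (2 * (κ + 1 / κ)))).add
      (hasDerivAt_joukowsky_moment_two hs.ne')).congr_deriv (by ring)
  rw [show ((2 : ℕ) : ℝ) + 3 / 2 = 7 / 2 by norm_num] at h
  rw [h, Real.log_pow, Real.log_pow]
  simp only [Pi.add_apply, Pi.sub_apply, Real.log_one]
  have : κ ≠ 0 := by positivity
  field_simp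
  push_cast
  ring

theorem abs_neg_sub_inv {k : ℝ} (hk : 1 ≤ |k|) : |-k - 1 / k| = |k| + 1 / |k| := by
  rcases le_abs'.mp hk with h | h
  · rw [abs_of_neg (by linarith : k < 0), abs_of_pos]
    · ring
    · have : 1 / k < 0 := one_div_neg.mpr (by linarith)
      linarith
  · have : 0 < 1 / k := one_div_pos.mpr (by linarith)
    rw [abs_of_pos (by linarith : 0 < k), abs_of_neg (by linarith)]
    ring

theorem existsUnique_joukowsky {x : ℝ} (hx : 2 < |x|) :
    ∃! k : ℝ, 1 ≤ |k| ∧ x = -k - 1 / k := by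
  have hmono {k k' : ℝ} (h : 1 ≤ |k|) (h' : 1 ≤ |k'|) (e : -k - 1 / k = -k' - 1 / k') : k = k' := by
    have hk : k ≠ 0 := abs_pos.mp (by linarith)
    have hk' : k' ≠ 0 := abs_pos.mp (by linarith)
    field_simp at e
    -- The two solutions are reciprocal; if `k k' = 1` with both moduli at least `1`, then `k = k' =
    -- ±1`.
    have h1 : (k - k') * (k * k' - 1) = 0 := by linear_combination -e
    rcases mul_eq_zero.mp h1 with h2 | h2
    · linarith
    · have h3 : k * k' = 1 := by linarith
      have h4 : |k| * |k'| = 1 := by rw [← abs_mul, h3, abs_one]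
      have h5 : |k| = 1 := by nlinarith
      rcases (abs_eq zero_le_one).mp h5 with h6 | h6 <;> rw [h6] at h3 ⊢ <;> linarith
  obtain ⟨h0, h1, h2, -⟩ := joukowskyInv_spec hx
  set a := joukowskyInv |x|
  have ha : 1 ≤ a⁻¹ := (one_le_inv₀ h0).mpr h1.le
  rcases abs_cases x with ⟨e, -⟩ | ⟨e, -⟩
  · refine ⟨-a⁻¹, ⟨by rwa [abs_neg, abs_of_pos (by positivity)], ?_⟩, fun k' hk' => ?_⟩
    · rw [← e, ← h2]; simp [add_comm]
    · refine hmono hk'.1 (by rwa [abs_neg, abs_of_pos (by positivity)]) ?_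
      rw [← hk'.2, ← e, ← h2]; simp [add_comm]
  · refine ⟨a⁻¹, ⟨by rwa [abs_of_pos (by positivity)], ?_⟩, fun k' hk' => ?_⟩
    · rw [eq_neg_iff_add_eq_zero.mpr (by linarith : x + |x| = 0), ← h2]; simp; ring
    · refine hmono hk'.1 (by rwa [abs_of_pos (by positivity)]) ?_
      rw [← hk'.2, eq_neg_iff_add_eq_zero.mpr (by linarith : x + |x| = 0), ← h2]; simp; ring

/-- Written over the fixed half-line `t > 0`, the integrand itself is monotone in `x`. -/
theorem GFun_mono {γ x y : ℝ} (hγ : 1 / 2 < γ) (hx : 2 < x) (hxy : x ≤ y) :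
    GFun γ x ≤ GFun γ y := by
  rw [← ENNReal.ofReal_le_ofReal_iff (GFun_nonneg γ (hx.le.trans hxy)),
    ← lintegral_rpow_mul_sqrt hγ hx, ← lintegral_rpow_mul_sqrt hγ (hx.trans_le hxy)]
  refine lintegral_mono fun t => ?_
  dsimp only
  gcongr
  split_ifs with h h'
  · exact Real.sqrt_le_sqrt (by nlinarith)
  · linarith
  · positivity
  · rfl

theorem GFun_pos {γ x : ℝ} (hγ : 1 / 2 < γ) (hx : 2 < x) : 0 < GFun γ x := by
  rw [GFun_eq_integral]
  refine intervalIntegral.intervalIntegral_pos_of_pos_on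
    ((intervalIntegral.intervalIntegrable_rpow' (by linarith)).mul_continuousOn
      (by fun_prop)) (fun t ht => ?_) (by linarith)
  refine mul_pos (Real.rpow_pos_of_pos ht.1 _) (Real.sqrt_pos.mpr ?_)
  nlinarith [ht.2]

end ClosedForms

/-! ### The main inequality -/

namespace MatrixJacobi

variable {m : ℕ} {W : MatrixJacobi m}

theorem two_lt_abs_of_mem_outerEigenvalues {x : ℝ} (hx : x ∈ W.outerEigenvalues) : 2 < |x| := by
  by_contra h
  exact hx.1 (abs_le.mp (not_lt.mp h))

theorem one_le_multiplicity (hW : W.IsDiscreteSchrodinger) {x : ℝ} (hx : x ∈ W.outerEigenvalues) :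
    1 ≤ W.multiplicity x := by
  have : FiniteDimensional ℂ (Module.End.eigenspace W.op (x : ℂ)) :=
    Module.rank_lt_aleph0_iff.mp ((rank_eigenspace_le hW x).trans_lt (Cardinal.natCast_lt_aleph0))
  exact Submodule.one_le_finrank_iff.mpr hx.2

/-- Eigenvalues above `2` are controlled by the positive part of `B`, those below `-2` by the
negative part, and `|y|^p = y₊^p + (-y)₊^p`; combining both signs costs no constant. -/
theorem sum_multiplicity_mul_GFun_le_trAbsPow (hW : W.IsDiscreteSchrodinger) (T : Finset ℝ)
    (hT : ∀ x ∈ T, 2 < |x|) {γ : ℝ} (hγ : 1 / 2 < γ)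
    (hB : Summable fun n : ℤ => trAbsPow (W.B n) (γ + 1 / 2)) :
    ∑ x ∈ T, (W.multiplicity x : ℝ) * GFun γ |x| ≤ ProbabilityTheory.beta (γ - 1 / 2) 2 *
      ∑' n, trAbsPow (W.B n) (γ + 1 / 2) := by
  have h1 := sum_multiplicity_mul_GFun_le hW 1 (T.filter (0 ≤ ·)) (fun x hx => by
    obtain ⟨hx, h0⟩ := Finset.mem_filter.mp hx
    simpa [abs_of_nonneg h0] using hT x hx) hγ hB
  have h2 := sum_multiplicity_mul_GFun_le hW (-1) (T.filter (¬ 0 ≤ ·)) (fun x hx => by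
    obtain ⟨hx, h0⟩ := Finset.mem_filter.mp hx
    simpa [abs_of_neg (not_le.mp h0)] using hT x hx) hγ hB
  rw [← Finset.sum_filter_add_sum_filter_not T (0 ≤ ·)]
  refine (add_le_add h1 h2).trans_eq ?_
  have hpow (y : ℝ) : |y| ^ (γ + 1 / 2) = max y 0 ^ (γ + 1 / 2) + max (-y) 0 ^ (γ + 1 / 2) := by
    rcases le_total 0 y with h | h
    · rw [abs_of_nonneg h, max_eq_left h, max_eq_right (by linarith : -y ≤ 0),
        Real.zero_rpow (by linarith), add_zero]
    · rw [abs_of_nonpos h, max_eq_right h, max_eq_left (by linarith : 0 ≤ -y),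
        Real.zero_rpow (by linarith), zero_add]
  have hs (σ : ℤˣ) : Summable fun n =>
      ∑ k, max (((σ : ℤ) : ℝ) * (W.isHermitian_B n).eigenvalues k) 0 ^ (γ + 1 / 2) := by
    refine Summable.of_nonneg_of_le
      (fun n => Finset.sum_nonneg fun k _ => Real.rpow_nonneg (le_max_right _ _) _) (fun n => ?_) hB
    rw [trAbsPow_eq_sum (W.isHermitian_B n)]
    refine Finset.sum_le_sum fun k _ => Real.rpow_le_rpow (le_max_right _ _)
      (max_le ?_ (abs_nonneg _)) (by linarith)
    rcases Int.units_eq_one_or σ with rfl | rfl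
    · simpa using le_abs_self _
    · simpa using neg_le_abs _
  rw [← mul_add, ← (hs 1).tsum_add (hs (-1))]
  congr 1
  refine tsum_congr fun n => ?_
  rw [trAbsPow_eq_sum (W.isHermitian_B n), ← Finset.sum_add_distrib]
  refine Finset.sum_congr rfl fun k _ => ?_
  rw [hpow]
  simp

/-- The Lieb–Thirring inequality for the moments `γ > 1/2`. -/
theorem liebThirring (hW : W.IsDiscreteSchrodinger) {γ : ℝ} (hγ : 1 / 2 < γ)
    (hB : Summable fun n : ℤ => trAbsPow (W.B n) (γ + 1 / 2)) :
    Summable (fun x : W.outerEigenvalues => (W.multiplicity x : ℝ) * GFun γ |(x : ℝ)|) ∧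
      ∑' x : W.outerEigenvalues, (W.multiplicity x : ℝ) * GFun γ |(x : ℝ)| ≤
        ProbabilityTheory.beta (γ - 1 / 2) 2 * ∑' n : ℤ, trAbsPow (W.B n) (γ + 1 / 2) := by
  have hle (T : Finset W.outerEigenvalues) :
      ∑ x ∈ T, (W.multiplicity x : ℝ) * GFun γ |(x : ℝ)| ≤
        ProbabilityTheory.beta (γ - 1 / 2) 2 * ∑' n : ℤ, trAbsPow (W.B n) (γ + 1 / 2) := by
    have h := sum_multiplicity_mul_GFun_le_trAbsPow hW (T.map (Function.Embedding.subtype _))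
      (fun x hx => by
        obtain ⟨y, -, rfl⟩ := Finset.mem_map.mp hx
        exact two_lt_abs_of_mem_outerEigenvalues y.2) hγ hB
    rwa [Finset.sum_map] at h
  have hs : Summable (fun x : W.outerEigenvalues =>
      (W.multiplicity x : ℝ) * GFun γ |(x : ℝ)|) :=
    summable_of_sum_le (fun x => mul_nonneg (Nat.cast_nonneg _)
      (GFun_nonneg γ (two_lt_abs_of_mem_outerEigenvalues x.2).le)) hle
  exact ⟨hs, hs.tsum_le_of_sum_le hle⟩

/-- The terms of a convergent sum tend to `0`, but each eigenvalue of modulus at least `2 + ε`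
contributes at least `G_γ(2 + ε) > 0`. -/
theorem finite_outerEigenvalues (hW : W.IsDiscreteSchrodinger) {γ : ℝ} (hγ : 1 / 2 < γ)
    (hB : Summable fun n : ℤ => trAbsPow (W.B n) (γ + 1 / 2)) {ε : ℝ} (hε : 0 < ε) :
    {x ∈ W.outerEigenvalues | 2 + ε ≤ |x|}.Finite := by
  have h := (liebThirring hW hγ hB).1.tendsto_cofinite_zero.eventually_lt_const
    (GFun_pos hγ (by linarith : 2 < 2 + ε))
  have hfin := (Filter.eventually_cofinite.mp h).image Subtype.val
  refine hfin.subset fun x hx => ⟨⟨x, hx.1⟩, ?_, rfl⟩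
  have h1 := GFun_mono hγ (by linarith : 2 < 2 + ε) hx.2
  have h2 : (1 : ℝ) ≤ W.multiplicity x := by exact_mod_cast one_le_multiplicity hW hx.1
  have h3 := GFun_pos hγ (by linarith : 2 < 2 + ε)
  simp only [Set.mem_ofPred_eq, not_lt]
  nlinarith

/-- The Lieb–Thirring inequality in terms of another expression `c * g` of the moment function. -/
theorem liebThirring_of_eq (hW : W.IsDiscreteSchrodinger) {γ p c : ℝ} (hγ : 1 / 2 < γ)
    (hp : γ + 1 / 2 = p) (hc : 0 < c) {g : ℝ → ℝ}
    (hg : ∀ x ∈ W.outerEigenvalues, GFun γ |x| = c * g x)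
    (hB : Summable fun n : ℤ => trAbsPow (W.B n) p) :
    Summable (fun x : W.outerEigenvalues => (W.multiplicity x : ℝ) * g x) ∧
      ∑' x : W.outerEigenvalues, (W.multiplicity x : ℝ) * g x ≤
        c⁻¹ * ProbabilityTheory.beta (γ - 1 / 2) 2 * ∑' n : ℤ, trAbsPow (W.B n) p := by
  subst hp
  obtain ⟨h1, h2⟩ := liebThirring hW hγ hB
  have he (x : W.outerEigenvalues) : (W.multiplicity x : ℝ) * g x =
      c⁻¹ * ((W.multiplicity x : ℝ) * GFun γ |(x : ℝ)|) := by
    rw [hg x x.2]; field_simp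
  simp only [he]
  refine ⟨h1.mul_left _, ?_⟩
  rw [tsum_mul_left, mul_assoc]
  gcongr

end MatrixJacobi

theorem mainTheorem3 (m : ℕ) (W : MatrixJacobi m) (hW : W.IsDiscreteSchrodinger) :
    -- multiplicities are at most `m` (in particular finite)
    (∀ x ∈ W.outerEigenvalues,
      Module.rank ℂ (Module.End.eigenspace W.op (x : ℂ)) ≤ (m : Cardinal)) ∧
    -- the sum is over a discrete set (enumerable by decreasing modulus); the inequality for every `γ > 1/2`
    (∀ γ : ℝ, 1 / 2 < γ →
      Summable (fun n : ℤ => trAbsPow (W.B n) (γ + 1 / 2)) →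
      Summable (fun x : W.outerEigenvalues => (W.multiplicity x : ℝ) * GFun γ |(x : ℝ)|) ∧
      (∀ ε : ℝ, 0 < ε → {x ∈ W.outerEigenvalues | 2 + ε ≤ |x|}.Finite) ∧
      ∑' x : W.outerEigenvalues, (W.multiplicity x : ℝ) * GFun γ |(x : ℝ)| ≤
        ProbabilityTheory.beta (γ - 1 / 2) 2 *
          ∑' n : ℤ, trAbsPow (W.B n) (γ + 1 / 2)) ∧
    -- explicit forms for `γ = 3/2, 5/2, 7/2` in terms of `x = -k - 1/k`, `|k| ≥ 1`
    (∀ x ∈ W.outerEigenvalues, ∃! k : ℝ, 1 ≤ |k| ∧ x = -k - 1 / k) ∧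
    (∀ k : ℝ → ℝ,
      (∀ x ∈ W.outerEigenvalues, 1 ≤ |k x| ∧ x = -k x - 1 / k x) →
      ((∀ x ∈ W.outerEigenvalues,
          GFun (3 / 2) |x| =
            1 / 2 * (k x ^ 2 - 1 / k x ^ 2 - Real.log (|k x| ^ 4))) ∧
        (∀ n : ℤ, ProbabilityTheory.beta (3 / 2 - 1 / 2) 2 * trAbsPow (W.B n) (3 / 2 + 1 / 2) =
          1 / 2 * (W.B n ^ 2).trace.re) ∧
        (Summable (fun n : ℤ => (W.B n ^ 2).trace.re) →
          Summable (fun x : W.outerEigenvalues => (W.multiplicity x : ℝ) *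
            (k x ^ 2 - 1 / k x ^ 2 - Real.log (|k x| ^ 4))) ∧
          ∑' x : W.outerEigenvalues, (W.multiplicity x : ℝ) *
            (k x ^ 2 - 1 / k x ^ 2 - Real.log (|k x| ^ 4)) ≤
            ∑' n : ℤ, (W.B n ^ 2).trace.re)) ∧
      ((∀ x ∈ W.outerEigenvalues,
          GFun (5 / 2) |x| =
            3 / 2 * (|k x| - 1 / |k x|) + 1 / 6 * (|k x| ^ 3 - 1 / |k x| ^ 3)
              - Real.log (|k x| ^ 2) * (|k x| + 1 / |k x|)) ∧
        (Summable (fun n : ℤ => trAbsPow (W.B n) 3) →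
          Summable (fun x : W.outerEigenvalues => (W.multiplicity x : ℝ) *
            (3 / 2 * (|k x| - 1 / |k x|) + 1 / 6 * (|k x| ^ 3 - 1 / |k x| ^ 3)
              - Real.log (|k x| ^ 2) * (|k x| + 1 / |k x|))) ∧
          ∑' x : W.outerEigenvalues, (W.multiplicity x : ℝ) *
            (3 / 2 * (|k x| - 1 / |k x|) + 1 / 6 * (|k x| ^ 3 - 1 / |k x| ^ 3)
              - Real.log (|k x| ^ 2) * (|k x| + 1 / |k x|)) ≤
            1 / 6 * ∑' n : ℤ, trAbsPow (W.B n) 3)) ∧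
      ((∀ x ∈ W.outerEigenvalues,
          GFun (7 / 2) |x| =
            1 / 12 * (k x ^ 4 - 1 / k x ^ 4) + 7 / 3 * (k x ^ 2 - 1 / k x ^ 2)
              - Real.log (|k x| ^ 2) * (k x ^ 2 + 1 / k x ^ 2) - Real.log (|k x| ^ 6)) ∧
        (Summable (fun n : ℤ => trAbsPow (W.B n) 4) →
          Summable (fun x : W.outerEigenvalues => (W.multiplicity x : ℝ) *
            (1 / 12 * (k x ^ 4 - 1 / k x ^ 4) + 7 / 3 * (k x ^ 2 - 1 / k x ^ 2)
              - Real.log (|k x| ^ 2) * (k x ^ 2 + 1 / k x ^ 2) - Real.log (|k x| ^ 6))) ∧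
          ∑' x : W.outerEigenvalues, (W.multiplicity x : ℝ) *
            (1 / 12 * (k x ^ 4 - 1 / k x ^ 4) + 7 / 3 * (k x ^ 2 - 1 / k x ^ 2)
              - Real.log (|k x| ^ 2) * (k x ^ 2 + 1 / k x ^ 2) - Real.log (|k x| ^ 6)) ≤
            1 / 12 * ∑' n : ℤ, trAbsPow (W.B n) 4))) := by
  have habs {k : ℝ → ℝ} (hk : ∀ x ∈ W.outerEigenvalues, 1 ≤ |k x| ∧ x = -k x - 1 / k x) {x : ℝ}
      (hx : x ∈ W.outerEigenvalues) : |x| = |k x| + 1 / |k x| := by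
    obtain ⟨h1, h2⟩ := hk x hx
    conv_lhs => rw [h2]
    exact abs_neg_sub_inv h1
  refine ⟨fun x _ => MatrixJacobi.rank_eigenspace_le hW x, fun γ hγ hB => ?_, fun x hx =>
    existsUnique_joukowsky (MatrixJacobi.two_lt_abs_of_mem_outerEigenvalues hx), fun k hk => ?_⟩
  · obtain ⟨h1, h2⟩ := MatrixJacobi.liebThirring hW hγ hB
    exact ⟨h1, fun ε hε => MatrixJacobi.finite_outerEigenvalues hW hγ hB hε, h2⟩
  · have e3 (x : ℝ) (hx : x ∈ W.outerEigenvalues) : GFun (3 / 2) |x| =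
        1 / 2 * (k x ^ 2 - 1 / k x ^ 2 - Real.log (|k x| ^ 4)) := by
      rw [habs hk hx, GFun_three_halves (hk x hx).1, sq_abs]
    have e5 (x : ℝ) (hx : x ∈ W.outerEigenvalues) : GFun (5 / 2) |x| =
        3 / 2 * (|k x| - 1 / |k x|) + 1 / 6 * (|k x| ^ 3 - 1 / |k x| ^ 3)
          - Real.log (|k x| ^ 2) * (|k x| + 1 / |k x|) := by
      rw [habs hk hx, GFun_five_halves (hk x hx).1]
    have e7 (x : ℝ) (hx : x ∈ W.outerEigenvalues) : GFun (7 / 2) |x| =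
        1 / 12 * (k x ^ 4 - 1 / k x ^ 4) + 7 / 3 * (k x ^ 2 - 1 / k x ^ 2)
          - Real.log (|k x| ^ 2) * (k x ^ 2 + 1 / k x ^ 2) - Real.log (|k x| ^ 6) := by
      rw [habs hk hx, GFun_seven_halves (hk x hx).1, Even.pow_abs (by decide : Even 4)]
      simp only [sq_abs]
    have htr (n : ℤ) : trAbsPow (W.B n) 2 = (W.B n ^ 2).trace.re :=
      trAbsPow_two (W.isHermitian_B n)
    refine ⟨⟨e3, fun n => ?_, fun hB => ?_⟩, ⟨e5, fun hB => ?_⟩, ⟨e7, fun hB => ?_⟩⟩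
    · rw [show (3 / 2 - 1 / 2 : ℝ) = 1 by norm_num, show (3 / 2 + 1 / 2 : ℝ) = 2 by norm_num,
        beta_two one_pos, htr]
      norm_num
    · simp only [← htr] at hB ⊢
      -- The Beta values `B(1,2)`, `B(2,2)`, `B(3,2)` are `1/2`, `1/6`, `1/12`; for `γ = 3/2` the
      -- factor `1/2` cancels on both sides.
      have h := MatrixJacobi.liebThirring_of_eq hW (γ := 3 / 2) (c := 1 / 2) (by norm_num)
        (by norm_num) (by norm_num) e3 hB
      rw [show (3 / 2 - 1 / 2 : ℝ) = 1 by norm_num, beta_two one_pos] at h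
      norm_num at h ⊢
      exact h
    · have h := MatrixJacobi.liebThirring_of_eq hW (γ := 5 / 2) (c := 1) (by norm_num)
        (by norm_num) one_pos (fun x hx => (e5 x hx).trans (one_mul _).symm) hB
      rw [show (5 / 2 - 1 / 2 : ℝ) = 2 by norm_num, beta_two two_pos] at h
      convert h using 3
      norm_num
    · have h := MatrixJacobi.liebThirring_of_eq hW (γ := 7 / 2) (c := 1) (by norm_num)
        (by norm_num) one_pos (fun x hx => (e7 x hx).trans (one_mul _).symm) hB
      rw [show (7 / 2 - 1 / 2 : ℝ) = 3 by norm_num, beta_two three_pos] at h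
      convert h using 3
      norm_num
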